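/- Let $K$ be a field of arbitrary characteristic, and let all Lie algebras be over $K$. A Lie algebra $L$ is of type $FP_s$ if the trivial $\mathcal U(L)$-module $K$ (over the universal enveloping algebra $\mathcal U(L)$) has a projective resolution $\dots \to P_1 \to P_0 \to K \to 0$ in which $P_i$ is finitely generated for every $i \le s$. A Lie subalgebra $L \le F_1 \oplus \dots \oplus F_k$ is a subdirect sum if it projects surjectively onto $F_i$ for every $1 \le i \le k$. Theorem A. Let $s \ge 2$ be a natural number and let $L \le F_1 \oplus \dots \oplus F_k$ be a subdirect sum of finitely generated non-abelian free Lie algebras $F_1, \dots, F_k$ such that $L$ is of type $FP_s$ and $L \cap F_i \ne 0$ for $1 \le i \le k$. Then for all $1 \le i_1 < i_2 < \dots < i_s \le k$ we have $$p_{i_1,\dots,i_s}(L) = F_{i_1} \oplus \dots \oplus F_{i_s},$$ where $p_{i_1,\dots,i_s} : F_1 \oplus \dots \oplus F_k \to F_{i_1} \oplus \dots \oplus F_{i_s}$ is the canonical projection. -/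

import Mathlib

open scoped DirectSum

universe u v w

/-- A projective resolution `⋯ → P 2 → P 1 → P 0 → M → 0` of a (left) module `M` over a ring `R`. -/
structure ModuleProjRes (R : Type u) [Ring R] (M : Type w) [AddCommGroup M] [Module R M] where
  /-- the modules of the resolution -/
  P : ℕ → Type (max u w)
  [addCommGroup : ∀ n, AddCommGroup (P n)]
  [module : ∀ n, Module R (P n)]
  projective : ∀ n, Module.Projective R (P n)
  /-- the differentials -/
  d : ∀ n, P (n + 1) →ₗ[R] P n
  /-- the augmentation -/
  ε : P 0 →ₗ[R] M
  ε_surjective : Function.Surjective ε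
  exact_zero : Function.Exact (d 0) ε
  exact_succ : ∀ n, Function.Exact (d (n + 1)) (d n)

attribute [instance] ModuleProjRes.addCommGroup ModuleProjRes.module

/-- `M` is of type `FP_s` over `R`: it has a projective resolution whose terms in dimensions
`≤ s` are finitely generated. -/
def ModuleIsFP (R : Type u) [Ring R] (M : Type w) [AddCommGroup M] [Module R M] (s : ℕ) : Prop :=
  ∃ C : ModuleProjRes R M, ∀ i, i ≤ s → Module.Finite R (C.P i)

namespace LieAlgebra

section

attribute [local instance 100] LieRing.ofAssociativeRing

variable (K : Type v) [Field K] (L : Type u) [LieRing L] [LieAlgebra K L]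

/-- The augmentation `𝒰(L) → K`, the `K`-algebra homomorphism that vanishes on `L`. -/
noncomputable def augmentation : UniversalEnvelopingAlgebra K L →ₐ[K] K :=
  UniversalEnvelopingAlgebra.lift K (0 : L →ₗ⁅K⁆ K)

/-- The trivial `𝒰(L)`-module `K`: a copy of `K` on which `𝒰(L)` acts through the augmentation. -/
@[nolint unusedArguments]
def TrivialUModule (K : Type v) [Field K] (L : Type u) [LieRing L] [LieAlgebra K L] : Type v := K

instance : AddCommGroup (TrivialUModule K L) := inferInstanceAs (AddCommGroup K)

noncomputable instance : Module (UniversalEnvelopingAlgebra K L) (TrivialUModule K L) :=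
  Module.compHom K (augmentation K L).toRingHom

/-- `L` acts as `0` on the trivial module. -/
theorem ι_smul_trivialUModule (x : L) (c : TrivialUModule K L) :
    UniversalEnvelopingAlgebra.ι K x • c = 0 := by
  have h : augmentation K L (UniversalEnvelopingAlgebra.ι K x) = 0 :=
    UniversalEnvelopingAlgebra.lift_ι_apply K (0 : L →ₗ⁅K⁆ K) x
  change (augmentation K L (UniversalEnvelopingAlgebra.ι K x)) * (show K from c) = 0
  rw [h, zero_mul]

/-- Scalars `K ⊆ 𝒰(L)` act on the trivial module by multiplication. -/
theorem algebraMap_smul_trivialUModule (a : K) (c : TrivialUModule K L) :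
    algebraMap K (UniversalEnvelopingAlgebra K L) a • c = (a * (show K from c) : K) := by
  change (augmentation K L (algebraMap K _ a)) * (show K from c) = _
  rw [AlgHom.commutes]
  rfl

/-- The Lie algebra `L` is of type `FP_s`: the trivial `𝒰(L)`-module `K` is of type `FP_s`. -/
def IsFP (s : ℕ) : Prop :=
  ModuleIsFP (UniversalEnvelopingAlgebra K L) (TrivialUModule K L) s

/-- `L` is a free Lie algebra over `K` (on some set, possibly infinite). -/
def IsFreeLie : Prop :=
  ∃ X : Type u, Nonempty (L ≃ₗ⁅K⁆ FreeLieAlgebra K X)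

/-- `L` is generated, as a Lie algebra over `K`, by a finite subset. -/
def IsFGLie : Prop :=
  ∃ S : Set L, S.Finite ∧ LieSubalgebra.lieSpan K L S = ⊤

end

section

variable (K : Type v) [Field K] {ι κ : Type*}
  (F : ι → Type u) [∀ i, LieRing (F i)] [∀ i, LieAlgebra K (F i)]

/-- For an injective `e : κ → ι`, the canonical projection of `⨁ i, F i` onto the direct sum of
the factors selected by `e`. -/
noncomputable def directSumProj (e : κ → ι) (he : Function.Injective e) :
    (⨁ i, F i) →ₗ⁅K⁆ (⨁ j, F (e j)) where
  toFun x := DFinsupp.comapDomain e he x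
  map_add' x y := DFinsupp.comapDomain_add e he x y
  map_smul' c x := DFinsupp.comapDomain_smul e he c x
  map_lie' := by
    intro x y
    refine DFinsupp.ext fun j => ?_
    rw [DirectSum.bracket_apply]
    exact DirectSum.bracket_apply F x y (e j)

theorem directSumProj_apply (e : κ → ι) (he : Function.Injective e) (x : ⨁ i, F i) (j : κ) :
    directSumProj K F e he x j = x (e j) := rfl

variable {F}

/-- `L ≤ ⨁ i, F i` is a subdirect sum: it projects onto each factor `F i`. -/
def IsSubdirectSum (L : LieSubalgebra K (⨁ i, F i)) : Prop :=
  ∀ i, L.map (DirectSum.lieAlgebraComponent K ι F i) = ⊤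

end

end LieAlgebra

/-! Surjectivity of `L` onto any `t` factors is proved by induction on `t`, with `t = 2` as a
separate base case.

Two factors (`FreeWords.exists_ker_eq`). Let `N` be the kernel of `L → F_i`, let `J` be the kernel
of `U(L) → U(F_i)`, and let `Δ` be the augmentation ideal of `U(L)`. Then `J / JΔ` is `H_1(N)`, a
module over the free associative algebra `R = U(F_i)`. By `FP_2` the ideal `Δ` is finitely
presented. Since the augmentation ideal of `R` is free, `H_1(N)` has the form `R^a / S` with `S`
finitely generated. A nonzero element of `L ∩ F_i` commutes with `N`, so it annihilates `H_1(N)`.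
Over a free algebra this makes `R^a / S` finite-dimensional (`exists_sub_mem_vecDegLT`). Let `I` be
the image of `N` in `F_j`. It is an ideal, and it is nonzero because `L ∩ F_j ≠ 0`. If `Q = F_j / I`
were nonzero, then `H_1(I)`, a finite-dimensional quotient of `H_1(N)`, would embed into a power of
`U(Q)`. By PBW a nonzero `q` in `Q` stabilizes no nonzero finite-dimensional subspace of `U(Q)`. So
`H_1(I) = 0`, and a degree argument gives `I = 0`, a contradiction.

From `t` to `t + 1` factors (`Subdirect.isSurj_succ`). If `L` misses a tuple on `t + 1` factors, a
linear functional `∑ χ_i` separates that tuple from the image of `L`. Surjectivity onto fewer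
factors forces every `χ_i` to be a nonzero character of `F_i`. Let `F_i` act on `K[t]` through `χ_i
t`. Freeness provides cocycles `c_i : F_i → K[t]` that take values of arbitrarily high degree on
iterated brackets. The characters cancel on `L`, so the cup product of the `c_i` is a class of
degree `t + 1` with coefficients in the trivial module `K[t]`. By `FP_{t+1}` a representing cocycle
takes values in a finite-dimensional space. Evaluated on the Koszul cycle of commuting elements `n_i
∈ L ∩ F_i` it gives, up to a nonzero scalar, `∏ c_i(n_i)`, whose degree is unbounded. -/

namespace PBW

open MvPolynomial

/-! ### Poincaré–Birkhoff–Witt: the action of a Lie algebra on polynomials in a basis. -/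

section Action

variable {K : Type*} [Field K] {I : Type*}

variable (K I) in
/-- The polynomials of total degree at most `d`, as the span of the monomials. -/
noncomputable def degLE (d : ℕ) : Submodule K (MvPolynomial I K) :=
  Submodule.span K ((fun m : I →₀ ℕ => monomial m (1 : K)) '' {m | m.degree ≤ d})

theorem monomial_mem_degLE {m : I →₀ ℕ} {d : ℕ} (h : m.degree ≤ d) :
    monomial m (1 : K) ∈ degLE K I d :=
  Submodule.subset_span ⟨m, h, rfl⟩

theorem degLE_mono {d e : ℕ} (h : d ≤ e) : degLE K I d ≤ degLE K I e :=
  Submodule.span_mono (Set.image_mono fun _ hm => le_trans hm h)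

theorem degLE_induction {V : Type*} [AddCommGroup V] [Module K V] {d : ℕ}
    (N : Submodule K V) (f : MvPolynomial I K →ₗ[K] V)
    (h : ∀ m : I →₀ ℕ, m.degree ≤ d → f (monomial m 1) ∈ N) {p : MvPolynomial I K}
    (hp : p ∈ degLE K I d) : f p ∈ N := by
  have : degLE K I d ≤ N.comap f := by
    rw [degLE, Submodule.span_le]
    rintro _ ⟨m, hm, rfl⟩
    exact h m hm
  exact this hp

theorem linearMap_eq_on_degLE {V : Type*} [AddCommGroup V] [Module K V] {d : ℕ}
    (f g : MvPolynomial I K →ₗ[K] V)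
    (h : ∀ m : I →₀ ℕ, m.degree ≤ d → f (monomial m 1) = g (monomial m 1))
    {p : MvPolynomial I K} (hp : p ∈ degLE K I d) : f p = g p := by
  have := degLE_induction (⊥ : Submodule K V) (f - g)
    (fun m hm => by simp [h m hm]) hp
  simpa [sub_eq_zero] using this

theorem exists_mem_degLE (p : MvPolynomial I K) : ∃ d, p ∈ degLE K I d := by
  induction p using MvPolynomial.induction_on' with
  | monomial m a =>
    refine ⟨m.degree, ?_⟩
    have : monomial m a = a • monomial m (1 : K) := by simp [smul_monomial]
    rw [this]
    exact Submodule.smul_mem _ _ (monomial_mem_degLE le_rfl)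
  | add p q hp hq =>
    obtain ⟨d, hd⟩ := hp
    obtain ⟨e, he⟩ := hq
    exact ⟨max d e, add_mem (degLE_mono (le_max_left _ _) hd) (degLE_mono (le_max_right _ _) he)⟩

theorem X_mul_monomial (i : I) (m : I →₀ ℕ) :
    (X i : MvPolynomial I K) * monomial m 1 = monomial (m + Finsupp.single i 1) 1 := by
  rw [X, monomial_mul, one_mul, add_comm]

theorem degree_add_single (i : I) (m : I →₀ ℕ) :
    (m + Finsupp.single i 1).degree = m.degree + 1 := by
  rw [map_add, Finsupp.degree_single]

theorem X_mul_mem_degLE (i : I) {d : ℕ} {p : MvPolynomial I K} (hp : p ∈ degLE K I d) :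
    X i * p ∈ degLE K I (d + 1) := by
  refine degLE_induction _ (LinearMap.mulLeft K (X i)) (fun m hm => ?_) hp
  rw [LinearMap.mulLeft_apply, X_mul_monomial]
  exact monomial_mem_degLE (by rw [degree_add_single]; omega)

variable {Q : Type*} [LieRing Q] [LieAlgebra K Q] [LinearOrder I] (b : Module.Basis I K Q)

/-- `i` is at most every index that occurs in `m`. -/
def IsLow (i : I) (m : I →₀ ℕ) : Prop := ∀ k ∈ m.support, i ≤ k

theorem exists_of_not_isLow {i : I} {m : I →₀ ℕ} (h : ¬ IsLow i m) :
    ∃ j n, m = n + Finsupp.single j 1 ∧ j < i ∧ IsLow j n := by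
  have hne : m.support.Nonempty := by
    rw [Finset.nonempty_iff_ne_empty]
    intro h0
    exact h (by intro k hk; simp [h0] at hk)
  have hmin := Finset.min'_mem _ hne
  refine ⟨m.support.min' hne, m - Finsupp.single (m.support.min' hne) 1, ?_, ?_, ?_⟩
  · rw [tsub_add_cancel_of_le]
    rw [Finsupp.single_le_iff]
    exact Nat.one_le_iff_ne_zero.2 (Finsupp.mem_support_iff.1 hmin)
  · by_contra hle
    exact h fun k hk => (not_lt.1 hle).trans (Finset.min'_le _ k hk)
  · intro k hk
    refine Finset.min'_le _ k ?_
    rw [Finsupp.mem_support_iff] at hk ⊢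
    intro h0
    apply hk
    simp [h0]

theorem IsLow.add_single {i j : I} {m : I →₀ ℕ} (h : IsLow i m) (hij : i ≤ j) :
    IsLow i (m + Finsupp.single j 1) := by
  intro k hk
  rcases eq_or_ne k j with rfl | hkj
  · exact hij
  · apply h
    simpa [Finsupp.single_apply, hkj.symm] using hk

theorem not_isLow_add_single {i j : I} {m : I →₀ ℕ} (hij : j < i) :
    ¬ IsLow i (m + Finsupp.single j 1) := fun h =>
  absurd (h j (by simp)) (not_le.2 hij)

theorem low_decomposition_unique {j j' : I} {n n' : I →₀ ℕ}
    (h : n + Finsupp.single j 1 = n' + Finsupp.single j' 1) (hj : IsLow j n) (hj' : IsLow j' n') :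
    j = j' ∧ n = n' := by
  have h1 : IsLow j (n + Finsupp.single j 1) := hj.add_single le_rfl
  have h2 : IsLow j' (n' + Finsupp.single j' 1) := hj'.add_single le_rfl
  have : j = j' := le_antisymm (h1 j' (by rw [h]; simp)) (h2 j (by rw [← h]; simp))
  subst this
  exact ⟨rfl, add_right_cancel h⟩

open Classical in
/-- Successive approximations of the action of the basis elements of a Lie algebra on the
polynomial ring on these elements; the `n`-th one is right in degrees at most `n`. -/
noncomputable def approx : ℕ → I → Module.End K (MvPolynomial I K)
  | 0, i => LinearMap.mulLeft K (X i)
  | n + 1, i => (basisMonomials I K).constr K fun m =>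
      if h : IsLow i m then monomial (m + Finsupp.single i 1) 1
      else
        let j := (exists_of_not_isLow h).choose
        let m' := (exists_of_not_isLow h).choose_spec.choose
        X i * monomial m 1 + approx n j (approx n i (monomial m' 1) - X i * monomial m' 1)
          + (b.repr ⁅b i, b j⁆).sum fun k c => c • approx n k (monomial m' 1)

open Classical in
theorem approx_of_isLow (n : ℕ) {i : I} {m : I →₀ ℕ} (h : IsLow i m) :
    approx b n i (monomial m 1) = monomial (m + Finsupp.single i 1) 1 := by
  cases n with
  | zero => simp only [approx, LinearMap.mulLeft_apply, X_mul_monomial]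
  | succ n =>
    have := (basisMonomials I K).constr_basis K (fun m =>
      if h : IsLow i m then monomial (m + Finsupp.single i 1) 1
      else
        let j := (exists_of_not_isLow h).choose
        let m' := (exists_of_not_isLow h).choose_spec.choose
        X i * monomial m 1 + approx b n j (approx b n i (monomial m' 1) - X i * monomial m' 1)
          + (b.repr ⁅b i, b j⁆).sum fun k c => c • approx b n k (monomial m' 1)) m
    rw [coe_basisMonomials, dif_pos h] at this
    exact this

open Classical in
theorem approx_succ_of_lt (n : ℕ) {i j : I} {m : I →₀ ℕ} (hji : j < i) (hj : IsLow j m) :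
    approx b (n + 1) i (monomial (m + Finsupp.single j 1) 1) =
      X i * monomial (m + Finsupp.single j 1) 1
        + approx b n j (approx b n i (monomial m 1) - X i * monomial m 1)
        + (b.repr ⁅b i, b j⁆).sum fun k c => c • approx b n k (monomial m 1) := by
  have h := not_isLow_add_single (m := m) hji
  have := (basisMonomials I K).constr_basis K (fun m =>
      if h : IsLow i m then monomial (m + Finsupp.single i 1) 1
      else
        let j := (exists_of_not_isLow h).choose
        let m' := (exists_of_not_isLow h).choose_spec.choose
        X i * monomial m 1 + approx b n j (approx b n i (monomial m' 1) - X i * monomial m' 1)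
          + (b.repr ⁅b i, b j⁆).sum fun k c => c • approx b n k (monomial m' 1))
        (m + Finsupp.single j 1)
  rw [coe_basisMonomials, dif_neg h] at this
  have hs := (exists_of_not_isLow h).choose_spec.choose_spec
  obtain ⟨e1, e2⟩ := low_decomposition_unique hs.1 hj hs.2.2
  dsimp only at this
  rw [← e2, ← e1] at this
  exact this

/-- A basis element acts as multiplication by its variable up to terms that do not raise the degree.
All later inductions on the degree rest on this. -/
theorem approx_sub_mem (n : ℕ) : ∀ (i : I) {d : ℕ} {p : MvPolynomial I K}, p ∈ degLE K I d →
    approx b n i p - X i * p ∈ degLE K I d := by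
  induction n with
  | zero =>
    intro i d p _
    simp [approx]
  | succ n ih =>
    intro i d p hp
    refine degLE_induction _ (approx b (n + 1) i - LinearMap.mulLeft K (X i)) (fun m hm => ?_) hp
    rw [LinearMap.sub_apply, LinearMap.mulLeft_apply]
    by_cases h : IsLow i m
    · rw [approx_of_isLow b _ h, X_mul_monomial, sub_self]
      exact zero_mem _
    · obtain ⟨j, m, rfl, hji, hj⟩ := exists_of_not_isLow h
      rw [degree_add_single] at hm
      have happ : ∀ k {e : ℕ} {q : MvPolynomial I K}, q ∈ degLE K I e →
          approx b n k q ∈ degLE K I (e + 1) := fun k e q hq => by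
        have := add_mem (degLE_mono (Nat.le_succ e) (ih k hq)) (X_mul_mem_degLE k hq)
        simpa using this
      rw [approx_succ_of_lt b n hji hj, add_assoc, add_sub_cancel_left]
      refine degLE_mono hm (add_mem (happ _ (ih _ (monomial_mem_degLE le_rfl))) ?_)
      exact Submodule.sum_mem _ fun k _ =>
        Submodule.smul_mem _ _ (happ _ (monomial_mem_degLE le_rfl))

/-- The recursion calls earlier approximations only on the shortened monomial and on its correction
term, both of smaller degree, so it stabilizes. -/
theorem approx_succ_eq (n : ℕ) : ∀ (i : I) {p : MvPolynomial I K}, p ∈ degLE K I n →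
    approx b (n + 1) i p = approx b n i p := by
  induction n with
  | zero =>
    intro i p hp
    refine linearMap_eq_on_degLE _ _ (fun m hm => ?_) hp
    have : IsLow i m := by
      have h0 : m = 0 := (Finsupp.degree_eq_zero_iff m).1 (by omega)
      intro k hk
      simp [h0] at hk
    rw [approx_of_isLow b _ this, approx_of_isLow b _ this]
  | succ n ih =>
    intro i p hp
    refine linearMap_eq_on_degLE _ _ (fun m hm => ?_) hp
    by_cases h : IsLow i m
    · rw [approx_of_isLow b _ h, approx_of_isLow b _ h]
    · obtain ⟨j, m, rfl, hji, hj⟩ := exists_of_not_isLow h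
      rw [degree_add_single] at hm
      have hm' : monomial m (1 : K) ∈ degLE K I n := monomial_mem_degLE (by omega)
      rw [approx_succ_of_lt b _ hji hj, approx_succ_of_lt b _ hji hj, ih i hm',
        ih j (approx_sub_mem b n i hm')]
      simp only [ih _ hm']

theorem approx_eq_of_le {n n' : ℕ} (h : n ≤ n') (i : I) {p : MvPolynomial I K}
    (hp : p ∈ degLE K I n) : approx b n' i p = approx b n i p := by
  induction n', h using Nat.le_induction with
  | base => rfl
  | succ k hk ih => rw [approx_succ_eq b k i (degLE_mono hk hp), ih]

/-- The action of a basis element on the polynomial ring. -/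
noncomputable def basisAct (i : I) : Module.End K (MvPolynomial I K) :=
  (basisMonomials I K).constr K fun m => approx b m.degree i (monomial m 1)

theorem basisAct_eq (i : I) {d : ℕ} {p : MvPolynomial I K} (hp : p ∈ degLE K I d) :
    basisAct b i p = approx b d i p := by
  refine linearMap_eq_on_degLE _ _ (fun m hm => ?_) hp
  have := (basisMonomials I K).constr_basis K
    (fun m => approx b m.degree i (monomial m 1)) m
  rw [coe_basisMonomials] at this
  rw [basisAct, this, approx_eq_of_le b hm i (monomial_mem_degLE le_rfl)]

/-- The action of the Lie algebra on the polynomial ring. -/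
noncomputable def act : Q →ₗ[K] Module.End K (MvPolynomial I K) := b.constr K (basisAct b)

theorem act_basis (i : I) : act b (b i) = basisAct b i := b.constr_basis K _ i

theorem act_of_isLow {i : I} {m : I →₀ ℕ} (h : IsLow i m) :
    act b (b i) (monomial m 1) = monomial (m + Finsupp.single i 1) 1 := by
  rw [act_basis, basisAct_eq b i (monomial_mem_degLE le_rfl), approx_of_isLow b _ h]

theorem act_sub_mem (i : I) {d : ℕ} {p : MvPolynomial I K} (hp : p ∈ degLE K I d) :
    act b (b i) p - X i * p ∈ degLE K I d := by
  rw [act_basis, basisAct_eq b i hp]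
  exact approx_sub_mem b d i hp

/-- This is the defining recursion, once one notes that `b j` acts on `m` and on `X i * m` as
multiplication by `X j`. -/
theorem act_lie_of_isLow {i j : I} {m : I →₀ ℕ} (hji : j < i) (hj : IsLow j m) :
    act b (b i) (act b (b j) (monomial m 1)) =
      act b (b j) (act b (b i) (monomial m 1)) + act b ⁅b i, b j⁆ (monomial m 1) := by
  have hm : monomial m (1 : K) ∈ degLE K I m.degree := monomial_mem_degLE le_rfl
  have h1 : act b (b i) (act b (b j) (monomial m 1)) =
      X i * monomial (m + Finsupp.single j 1) 1
        + act b (b j) (act b (b i) (monomial m 1) - X i * monomial m 1)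
        + act b ⁅b i, b j⁆ (monomial m 1) := by
    rw [act_of_isLow b hj, act_basis, act_basis, basisAct_eq b i (d := m.degree + 1)
      (monomial_mem_degLE (by rw [degree_add_single])), approx_succ_of_lt b _ hji hj,
      basisAct_eq b i hm, basisAct_eq b j (approx_sub_mem b _ i hm)]
    congr 1
    rw [act, Module.Basis.constr_apply, Finsupp.sum, Finsupp.sum, LinearMap.sum_apply]
    refine Finset.sum_congr rfl fun k _ => ?_
    rw [LinearMap.smul_apply, basisAct_eq b k hm]
  have h2 : act b (b j) (X i * monomial m 1) = X i * monomial (m + Finsupp.single j 1) 1 := by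
    rw [X_mul_monomial, act_of_isLow b (hj.add_single hji.le), X_mul_monomial, add_right_comm]
  rw [h1, map_sub, h2]
  abel

/-- If `j` is not low, the monomial has a smallest factor `k < j < i`. Moving `b i` and `b j` past
`b k` and using lower degrees leaves exactly the Jacobi identity. -/
theorem act_lie_aux (d : ℕ) : ∀ {p : MvPolynomial I K}, p ∈ degLE K I d → ∀ x y : Q,
    act b x (act b y p) = act b y (act b x p) + act b ⁅x, y⁆ p := by
  induction d using Nat.strong_induction_on with
  | _ d ih =>
  have key : ∀ m : I →₀ ℕ, m.degree ≤ d → ∀ i j, j < i →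
      act b (b i) (act b (b j) (monomial m 1)) =
      act b (b j) (act b (b i) (monomial m 1)) + act b ⁅b i, b j⁆ (monomial m 1) := by
    intro m hm i j hji
    by_cases h : IsLow j m
    · exact act_lie_of_isLow b hji h
    obtain ⟨k, n, rfl, hkj, hk⟩ := exists_of_not_isLow h
    rw [degree_add_single] at hm
    have hn : monomial n (1 : K) ∈ degLE K I n.degree := monomial_mem_degLE le_rfl
    have ihn := ih n.degree (by omega) hn
    -- The induction hypothesis may fail to cover `b j'` applied to `n`, whose degree can reach `d`.
    -- Its leading term still has `k` low, and the remainder has smaller degree.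
    have step : ∀ i' j', k < i' → k < j' →
        act b (b i') (act b (b k) (act b (b j') (monomial n 1))) =
        act b (b k) (act b (b i') (act b (b j') (monomial n 1)))
          + act b ⁅b i', b k⁆ (act b (b j') (monomial n 1)) := by
      intro i' j' hi' hj'
      have e : act b (b j') (monomial n 1) = monomial (n + Finsupp.single j' 1) 1 +
          (act b (b j') (monomial n 1) - X j' * monomial n 1) := by
        rw [X_mul_monomial]; abel
      have h1 := act_lie_of_isLow b hi' (hk.add_single hj'.le)
      have h2 := ih n.degree (by omega) (act_sub_mem b j' hn) (b i') (b k)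
      rw [e]
      generalize (act b (b j') (monomial n 1) - X j' * monomial n 1) = w at h2
      simp only [map_add, h1, h2]
      abel
    rw [← act_of_isLow b hk]
    rw [ihn (b j) (b k), ihn (b i) (b k)]
    simp only [map_add]
    rw [step i j (hkj.trans hji) hkj, step j i hkj (hkj.trans hji), ihn (b i) (b j),
      ihn ⁅b i, b k⁆ (b j), ihn (b i) ⁅b j, b k⁆, ihn ⁅b i, b j⁆ (b k)]
    have jac : ⁅⁅b i, b j⁆, b k⁆ = ⁅⁅b i, b k⁆, b j⁆ + ⁅b i, ⁅b j, b k⁆⁆ := by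
      rw [lie_lie (b i) (b j) (b k), ← lie_skew (b j) ⁅b i, b k⁆]; abel
    rw [jac]
    simp only [map_add, LinearMap.add_apply]
    abel
  intro p hp x y
  suffices H : ∀ i j, act b (b i) (act b (b j) p) =
      act b (b j) (act b (b i) p) + act b ⁅b i, b j⁆ p by
    let f : Q →ₗ[K] Q →ₗ[K] MvPolynomial I K := LinearMap.mk₂ K
      (fun x y => act b x (act b y p) - act b y (act b x p) - act b ⁅x, y⁆ p)
      (by intros; simp only [map_add, LinearMap.add_apply, add_lie]; abel)
      (by intros; simp only [map_smul, LinearMap.smul_apply, smul_lie, smul_sub])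
      (by intros; simp only [map_add, LinearMap.add_apply, lie_add]; abel)
      (by intros; simp only [map_smul, LinearMap.smul_apply, lie_smul, smul_sub])
    have hf : f = 0 := b.ext fun i => b.ext fun j => by
      change act b (b i) (act b (b j) p) - act b (b j) (act b (b i) p) - act b ⁅b i, b j⁆ p = 0
      rw [H]; abel
    have := LinearMap.congr_fun₂ hf x y
    change act b x (act b y p) - act b y (act b x p) - act b ⁅x, y⁆ p = 0 at this
    rw [sub_sub, sub_eq_zero] at this
    exact this
  intro i j
  refine linearMap_eq_on_degLE (act b (b i) ∘ₗ act b (b j))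
    (act b (b j) ∘ₗ act b (b i) + act b ⁅b i, b j⁆) (fun m hm => ?_) hp
  simp only [LinearMap.comp_apply, LinearMap.add_apply]
  rcases lt_trichotomy i j with hij | rfl | hij
  · rw [key m hm j i hij, ← lie_skew (b i) (b j), map_neg, LinearMap.neg_apply]
    abel
  · simp
  · exact key m hm i j hij

theorem act_lie (x y : Q) (p : MvPolynomial I K) :
    act b x (act b y p) = act b y (act b x p) + act b ⁅x, y⁆ p := by
  obtain ⟨d, hd⟩ := exists_mem_degLE p
  exact act_lie_aux b d hd x y

attribute [local instance 100] LieRing.ofAssociativeRing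

/-- The action of the Lie algebra on the polynomial ring, as a homomorphism of Lie algebras. -/
noncomputable def actHom : Q →ₗ⁅K⁆ Module.End K (MvPolynomial I K) where
  __ := act b
  map_lie' {x y} := by
    refine LinearMap.ext fun p => ?_
    change act b ⁅x, y⁆ p = act b x (act b y p) - act b y (act b x p)
    rw [act_lie b x y p]
    abel

/-- The symbol map `𝒰(Q) → K[I]`, the action on `1`. -/
noncomputable def symbol : UniversalEnvelopingAlgebra K Q →ₗ[K] MvPolynomial I K :=
  (LinearMap.applyₗ (1 : MvPolynomial I K)) ∘ₗ
    (UniversalEnvelopingAlgebra.lift K (actHom b)).toLinearMap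

theorem symbol_apply (u : UniversalEnvelopingAlgebra K Q) :
    symbol b u = UniversalEnvelopingAlgebra.lift K (actHom b) u 1 := rfl

theorem symbol_ι_mul (x : Q) (u : UniversalEnvelopingAlgebra K Q) :
    symbol b (UniversalEnvelopingAlgebra.ι K x * u) = act b x (symbol b u) := by
  rw [symbol_apply, map_mul, UniversalEnvelopingAlgebra.lift_ι_apply]
  rfl

theorem symbol_one : symbol b (1 : UniversalEnvelopingAlgebra K Q) = 1 := by
  rw [symbol_apply, map_one (UniversalEnvelopingAlgebra.lift K (actHom b))]
  rfl

theorem symbol_ι_basis (i : I) :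
    symbol b (UniversalEnvelopingAlgebra.ι K (b i)) = X i := by
  have h := symbol_ι_mul b (b i) 1
  rw [mul_one, symbol_one] at h
  have h0 : IsLow i (0 : I →₀ ℕ) := fun k hk => by simp at hk
  have h1 := act_of_isLow b h0
  rw [zero_add] at h1
  exact h.trans h1

/-- The least index is low for every monomial, so no correction term ever appears. -/
theorem act_eq_mul_of_least {i : I} (hi : ∀ k, i ≤ k) (p : MvPolynomial I K) :
    act b (b i) p = X i * p := by
  obtain ⟨d, hd⟩ := exists_mem_degLE p
  refine linearMap_eq_on_degLE _ (LinearMap.mulLeft K (X i)) (fun m _ => ?_) hd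
  rw [act_of_isLow b fun k _ => hi k, LinearMap.mulLeft_apply, X_mul_monomial]

/-- The linear map that sends a monomial to the product of its factors in increasing order. -/
noncomputable def orderedProd : MvPolynomial I K →ₗ[K] UniversalEnvelopingAlgebra K Q :=
  (basisMonomials I K).constr K fun m =>
    (((Finsupp.toMultiset m).sort (· ≤ ·)).map
      fun i => UniversalEnvelopingAlgebra.ι K (b i)).prod

theorem orderedProd_monomial (m : I →₀ ℕ) :
    orderedProd b (monomial m 1) = (((Finsupp.toMultiset m).sort (· ≤ ·)).map
      fun i => UniversalEnvelopingAlgebra.ι K (b i)).prod := by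
  have := (basisMonomials I K).constr_basis K (fun m : I →₀ ℕ =>
    (((Finsupp.toMultiset m).sort (· ≤ ·)).map
      fun i => UniversalEnvelopingAlgebra.ι K (b i)).prod) m
  rw [coe_basisMonomials] at this
  exact this

theorem orderedProd_of_isLow {i : I} {m : I →₀ ℕ} (h : IsLow i m) :
    orderedProd b (monomial (m + Finsupp.single i 1) 1) =
      UniversalEnvelopingAlgebra.ι K (b i) * orderedProd b (monomial m 1) := by
  have h' : ∀ k ∈ Finsupp.toMultiset m, i ≤ k := fun k hk => h k (by
    simpa [Finsupp.mem_toMultiset] using hk)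
  rw [orderedProd_monomial, orderedProd_monomial, map_add, Finsupp.toMultiset_single, one_smul,
    add_comm, Multiset.singleton_add, Multiset.sort_cons _ _ _ h', List.map_cons, List.prod_cons]

/-- This equivariance makes `orderedProd` a left inverse of `symbol`. A factor that is out of order
is exchanged by the commutator relation, at the cost of terms of smaller degree. -/
theorem orderedProd_act_aux (d : ℕ) : ∀ {p : MvPolynomial I K}, p ∈ degLE K I d → ∀ x : Q,
    orderedProd b (act b x p) = UniversalEnvelopingAlgebra.ι K x * orderedProd b p := by
  induction d using Nat.strong_induction_on with
  | _ d ih =>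
  intro p hp x
  suffices H : ∀ i, orderedProd b (act b (b i) p) =
      UniversalEnvelopingAlgebra.ι K (b i) * orderedProd b p by
    have : orderedProd b ∘ₗ LinearMap.applyₗ p ∘ₗ act b =
        LinearMap.mulRight K (orderedProd b p) ∘ₗ
          ((UniversalEnvelopingAlgebra.ι K : Q →ₗ⁅K⁆ _) : Q →ₗ[K] _) :=
      b.ext fun i => H i
    exact LinearMap.congr_fun this x
  intro i
  refine linearMap_eq_on_degLE (orderedProd b ∘ₗ act b (b i))
    (LinearMap.mulLeft K (UniversalEnvelopingAlgebra.ι K (b i)) ∘ₗ orderedProd b)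
    (fun m hm => ?_) hp
  simp only [LinearMap.comp_apply, LinearMap.mulLeft_apply]
  by_cases h : IsLow i m
  · rw [act_of_isLow b h, orderedProd_of_isLow b h]
  · obtain ⟨j, n, rfl, hji, hj⟩ := exists_of_not_isLow h
    rw [degree_add_single] at hm
    have hn : monomial n (1 : K) ∈ degLE K I n.degree := monomial_mem_degLE le_rfl
    have ihn := ih n.degree (by omega) hn
    have e : act b (b i) (monomial n 1) = monomial (n + Finsupp.single i 1) 1 +
        (act b (b i) (monomial n 1) - X i * monomial n 1) := by
      rw [X_mul_monomial]; abel
    have hstep : orderedProd b (act b (b j) (act b (b i) (monomial n 1))) =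
        UniversalEnvelopingAlgebra.ι K (b j) * orderedProd b (act b (b i) (monomial n 1)) := by
      have h2 := ih n.degree (by omega) (act_sub_mem b i hn) (b j)
      rw [e]
      generalize (act b (b i) (monomial n 1) - X i * monomial n 1) = w at h2
      have hl := hj.add_single hji.le
      rw [map_add, map_add, map_add, mul_add, h2, act_of_isLow b hl, orderedProd_of_isLow b hl]
    rw [← act_of_isLow b hj, act_lie, map_add, hstep, ihn, ihn, ihn, LieHom.map_lie,
      LieRing.of_associative_ring_bracket]
    noncomm_ring

theorem orderedProd_act (x : Q) (p : MvPolynomial I K) :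
    orderedProd b (act b x p) = UniversalEnvelopingAlgebra.ι K x * orderedProd b p := by
  obtain ⟨d, hd⟩ := exists_mem_degLE p
  exact orderedProd_act_aux b d hd x

theorem orderedProd_one : orderedProd b 1 = 1 := by
  have := orderedProd_monomial b 0
  simpa using this

end Action

/-! ### Consequences of PBW in the enveloping algebra. -/

section UEA

attribute [local instance 100] LieRing.ofAssociativeRing

variable {K : Type*} [Field K] {Q : Type*} [LieRing Q] [LieAlgebra K Q]

variable (K Q) in
theorem adjoin_range_ι :
    Algebra.adjoin K (Set.range (UniversalEnvelopingAlgebra.ι K : Q → _)) = ⊤ := by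
  let S := Algebra.adjoin K (Set.range (UniversalEnvelopingAlgebra.ι K : Q → _))
  let f : Q →ₗ⁅K⁆ S :=
    { toFun := fun x => ⟨UniversalEnvelopingAlgebra.ι K x, Algebra.subset_adjoin ⟨x, rfl⟩⟩
      map_add' := fun x y => Subtype.ext (map_add _ x y)
      map_smul' := fun c x => Subtype.ext (map_smul _ c x)
      map_lie' := fun {x y} => Subtype.ext (LieHom.map_lie _ x y) }
  have h : S.val.comp (UniversalEnvelopingAlgebra.lift K f) = AlgHom.id K _ := by
    apply UniversalEnvelopingAlgebra.hom_ext
    ext x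
    change ((UniversalEnvelopingAlgebra.lift K f (UniversalEnvelopingAlgebra.ι K x) : S) :
      UniversalEnvelopingAlgebra K Q) = UniversalEnvelopingAlgebra.ι K x
    rw [UniversalEnvelopingAlgebra.lift_ι_apply]
    rfl
  rw [eq_top_iff]
  intro u _
  have := DFunLike.congr_fun h u
  rw [← AlgHom.id_apply (R := K) u, ← this]
  exact (UniversalEnvelopingAlgebra.lift K f u).2

theorem smul_mem_of_ι_smul_mem {V : Type*} [AddCommGroup V] [Module K V]
    [Module (UniversalEnvelopingAlgebra K Q) V] [IsScalarTower K (UniversalEnvelopingAlgebra K Q) V]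
    (N : Submodule K V) (h : ∀ (x : Q), ∀ v ∈ N, UniversalEnvelopingAlgebra.ι K x • v ∈ N)
    (u : UniversalEnvelopingAlgebra K Q) {v : V} (hv : v ∈ N) : u • v ∈ N := by
  have hu : u ∈ Algebra.adjoin K (Set.range (UniversalEnvelopingAlgebra.ι K : Q → _)) := by
    rw [adjoin_range_ι]; trivial
  induction hu using Algebra.adjoin_induction generalizing v with
  | mem _ hx => obtain ⟨x, rfl⟩ := hx; exact h x v hv
  | algebraMap c => rw [algebraMap_smul]; exact N.smul_mem c hv
  | add _ _ _ _ h1 h2 => rw [add_smul]; exact add_mem (h1 hv) (h2 hv)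
  | mul _ _ _ _ h1 h2 => rw [mul_smul]; exact h1 (h2 hv)

theorem orderedProd_symbol {I : Type*} [LinearOrder I] (b : Module.Basis I K Q)
    (u : UniversalEnvelopingAlgebra K Q) : orderedProd b (symbol b u) = u := by
  have := smul_mem_of_ι_smul_mem
    (LinearMap.eqLocus (orderedProd b ∘ₗ symbol b) LinearMap.id) (fun x v hv => by
      rw [LinearMap.mem_eqLocus] at hv ⊢
      simp only [LinearMap.comp_apply, LinearMap.id_apply] at hv ⊢
      rw [smul_eq_mul, symbol_ι_mul, orderedProd_act, hv]) u (v := 1) (by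
      rw [LinearMap.mem_eqLocus, LinearMap.comp_apply, symbol_one, orderedProd_one]
      rfl)
  rw [smul_eq_mul, mul_one, LinearMap.mem_eqLocus] at this
  exact this

theorem symbol_injective {I : Type*} [LinearOrder I] (b : Module.Basis I K Q) :
    Function.Injective (symbol b) :=
  Function.LeftInverse.injective (orderedProd_symbol b)

variable (K Q) in
/-- A Lie algebra over a field embeds into its universal enveloping algebra. -/
theorem ι_injective : Function.Injective (UniversalEnvelopingAlgebra.ι K : Q → _) := by
  classical
  let b := Module.Basis.ofVectorSpace K Q
  let _ : LinearOrder (Module.Basis.ofVectorSpaceIndex K Q) := linearOrderOfSTO WellOrderingRel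
  let s : Q →ₗ[K] MvPolynomial _ K :=
    symbol b ∘ₗ ((UniversalEnvelopingAlgebra.ι K : Q →ₗ⁅K⁆ _) : Q →ₗ[K] _)
  have hs : s = Finsupp.linearCombination K (fun i => X i) ∘ₗ b.repr.toLinearMap :=
    b.ext fun i => by
      refine (symbol_ι_basis b i).trans ?_
      rw [LinearMap.comp_apply, LinearEquiv.coe_coe, b.repr_self, Finsupp.linearCombination_single,
        one_smul]
  have : Function.Injective s := by
    rw [hs, LinearMap.coe_comp]
    exact Function.Injective.comp (MvPolynomial.linearIndependent_X _ K) b.repr.injective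
  exact Function.Injective.of_comp (f := symbol b) this

/-- It lets a prescribed nonzero element of the Lie algebra be the least basis element, so that it
acts on symbols as a variable. -/
theorem exists_linearOrder_least {α : Type*} (a : α) :
    ∃ _ : LinearOrder α, ∀ k : α, a ≤ k := by
  classical
  let _ : LinearOrder α := linearOrderOfSTO WellOrderingRel
  let f : α → WithBot α := fun i => if i = a then ⊥ else (i : WithBot α)
  have hf : Function.Injective f := by
    intro i j hij
    dsimp only [f] at hij
    split_ifs at hij with h1 h2 h2
    · rw [h1, h2]
    · exact absurd hij.symm WithBot.coe_ne_bot
    · exact absurd hij WithBot.coe_ne_bot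
    · exact WithBot.coe_injective hij
  refine ⟨LinearOrder.lift' f hf, fun k => ?_⟩
  change f a ≤ f k
  simp [f]

/-- A finite-dimensional subspace of an enveloping algebra that is stable under multiplication by
a nonzero element of the Lie algebra vanishes. -/
theorem eq_bot_of_ι_mul_mem {q : Q} (hq : q ≠ 0) (V : Submodule K (UniversalEnvelopingAlgebra K Q))
    [FiniteDimensional K V] (hV : ∀ v ∈ V, UniversalEnvelopingAlgebra.ι K q * v ∈ V) : V = ⊥ := by
  have hli : LinearIndepOn K id ({q} : Set Q) := LinearIndepOn.singleton (v := id) hq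
  let b := Module.Basis.extend hli
  let i₀ : hli.extend (Set.subset_univ _) := ⟨q, hli.subset_extend _ rfl⟩
  have hb : b i₀ = q := Module.Basis.extend_apply_self hli i₀
  obtain ⟨_, hleast⟩ := exists_linearOrder_least i₀
  rw [Submodule.eq_bot_iff]
  intro v hv
  -- On symbols `T` is multiplication by a variable. The minimal polynomial of `T`, evaluated at
  -- that variable, therefore kills the symbol of `v`; but it is a nonzero element of a domain.
  let T : V →ₗ[K] V :=
    (LinearMap.mulLeft K (UniversalEnvelopingAlgebra.ι K q)).restrict hV
  have hint : IsIntegral K T := Algebra.IsIntegral.isIntegral T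
  let f := minpoly K T
  have hf : f ≠ 0 := minpoly.ne_zero hint
  have hT : ∀ (g : Polynomial K) (w : V), symbol b (Polynomial.aeval T g w : V) =
      Polynomial.aeval (X i₀ : MvPolynomial _ K) g * symbol b w := by
    intro g w
    induction g using Polynomial.induction_on' with
    | add g h hg hh => simp only [map_add, LinearMap.add_apply, Submodule.coe_add, hg, hh, add_mul]
    | monomial n a =>
      have hpow : symbol b ((T ^ n) w : V) = (X i₀ : MvPolynomial _ K) ^ n * symbol b w := by
        induction n with
        | zero => simp
        | succ n ih =>
          rw [pow_succ', pow_succ', mul_assoc, ← ih, Module.End.mul_apply,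
            ← act_eq_mul_of_least b hleast, hb, ← symbol_ι_mul]
          rfl
      rw [Polynomial.aeval_monomial, Polynomial.aeval_monomial, Module.End.mul_apply,
        Module.algebraMap_end_apply, Submodule.coe_smul, map_smul, hpow, Algebra.smul_def, mul_assoc]
  have h0 := hT f ⟨v, hv⟩
  rw [minpoly.aeval, LinearMap.zero_apply, Submodule.coe_zero, map_zero] at h0
  rcases mul_eq_zero.1 h0.symm with h1 | h1
  · exact absurd h1 (fun h1 => hf ((transcendental_iff.1 (transcendental_X K i₀)) f h1))
  · exact symbol_injective b (h1.trans (map_zero _).symm)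

end UEA

end PBW

/-! ### Initial and final letters in the free associative algebra. -/

namespace FreeWords

open MonoidAlgebra

variable {K : Type*} [Field K] {X : Type*}

/-- The generator of the free algebra that belongs to `x`. -/
noncomputable def gen (x : X) : MonoidAlgebra K (FreeMonoid X) := single (FreeMonoid.of x) 1

theorem coeff_gen_mul_of_mul (x : X) (r : MonoidAlgebra K (FreeMonoid X)) (w : FreeMonoid X) :
    (gen x * r).coeff (FreeMonoid.of x * w) = r.coeff w := by
  rw [gen, coeff_single_mul_eq_mul_coeff w, one_mul]
  intro m _
  exact mul_right_inj _

theorem coeff_gen_mul_of_ne {x y : X} (h : x ≠ y) (r : MonoidAlgebra K (FreeMonoid X))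
    (w : FreeMonoid X) : (gen y * r).coeff (FreeMonoid.of x * w) = 0 := by
  rw [gen, coeff_single_mul_of_forall_mul_ne]
  intro d hd
  exact h (List.cons_eq_cons.1 hd).1.symm

theorem coeff_gen_mul_one (x : X) (r : MonoidAlgebra K (FreeMonoid X)) :
    (gen x * r).coeff 1 = 0 := by
  rw [gen, coeff_single_mul_of_forall_mul_ne]
  intro d hd
  exact List.cons_ne_nil _ _ hd

theorem coeff_mul_gen_mul_of (x : X) (r : MonoidAlgebra K (FreeMonoid X)) (w : FreeMonoid X) :
    (r * gen x).coeff (w * FreeMonoid.of x) = r.coeff w := by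
  rw [gen, coeff_mul_single_eq_coeff_mul w, mul_one]
  intro m _
  exact mul_left_inj _

theorem coeff_mul_gen_of_ne {x y : X} (h : x ≠ y) (r : MonoidAlgebra K (FreeMonoid X))
    (w : FreeMonoid X) : (r * gen y).coeff (w * FreeMonoid.of x) = 0 := by
  rw [gen, coeff_mul_single_of_forall_mul_ne]
  intro d hd
  have := (List.append_inj' hd rfl).2
  exact h (List.cons_eq_cons.1 this).1.symm

theorem coeff_mul_gen_one (x : X) (r : MonoidAlgebra K (FreeMonoid X)) :
    (r * gen x).coeff 1 = 0 := by
  rw [gen, coeff_mul_single_of_forall_mul_ne]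
  intro d hd
  exact List.cons_ne_nil _ _ (List.append_eq_nil_iff.1 hd).2

theorem eq_one_or_eq_mul_of (w : FreeMonoid X) : w = 1 ∨ ∃ (v : FreeMonoid X) (x : X),
    w = v * FreeMonoid.of x := by
  rcases List.eq_nil_or_concat w.toList with h | ⟨l, x, h⟩
  · left; exact h
  · right; exact ⟨FreeMonoid.ofList l, x, by
      apply FreeMonoid.toList.injective
      rw [h]; simp⟩

theorem eq_one_or_eq_of_mul (w : FreeMonoid X) : w = 1 ∨ ∃ (x : X) (v : FreeMonoid X),
    w = FreeMonoid.of x * v := by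
  cases w using FreeMonoid.casesOn with
  | one => left; rfl
  | of_mul x v => right; exact ⟨x, v, rfl⟩

/-- The part of an element of the free algebra that follows an initial letter `x`. -/
noncomputable def ld (x : X) : MonoidAlgebra K (FreeMonoid X) →ₗ[K] MonoidAlgebra K (FreeMonoid X) where
  toFun r := ofCoeff (Finsupp.comapDomain (FreeMonoid.of x * ·) r.coeff
    (mul_right_injective _).injOn)
  map_add' r s := by ext w; simp
  map_smul' c r := by ext w; simp

theorem coeff_ld (x : X) (r : MonoidAlgebra K (FreeMonoid X)) (w : FreeMonoid X) :
    (ld x r).coeff w = r.coeff (FreeMonoid.of x * w) := rfl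

/-- The part of an element of the free algebra that precedes a final letter `x`. -/
noncomputable def rd (x : X) : MonoidAlgebra K (FreeMonoid X) →ₗ[K] MonoidAlgebra K (FreeMonoid X) where
  toFun r := ofCoeff (Finsupp.comapDomain (· * FreeMonoid.of x) r.coeff
    (mul_left_injective _).injOn)
  map_add' r s := by ext w; simp
  map_smul' c r := by ext w; simp

theorem coeff_rd (x : X) (r : MonoidAlgebra K (FreeMonoid X)) (w : FreeMonoid X) :
    (rd x r).coeff w = r.coeff (w * FreeMonoid.of x) := rfl

theorem ld_gen_mul_self (x : X) (r : MonoidAlgebra K (FreeMonoid X)) : ld x (gen x * r) = r := by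
  ext w; rw [coeff_ld, coeff_gen_mul_of_mul]

theorem ld_gen_mul_of_ne {x y : X} (h : x ≠ y) (r : MonoidAlgebra K (FreeMonoid X)) :
    ld x (gen y * r) = 0 := by
  ext w; rw [coeff_ld, coeff_gen_mul_of_ne h]; rfl

theorem rd_mul_gen_self (x : X) (r : MonoidAlgebra K (FreeMonoid X)) : rd x (r * gen x) = r := by
  ext w; rw [coeff_rd, coeff_mul_gen_mul_of]

theorem rd_mul_gen_of_ne {x y : X} (h : x ≠ y) (r : MonoidAlgebra K (FreeMonoid X)) :
    rd x (r * gen y) = 0 := by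
  ext w; rw [coeff_rd, coeff_mul_gen_of_ne h]; rfl

theorem of_mul_ne_one (x : X) (w : FreeMonoid X) : FreeMonoid.of x * w ≠ 1 := List.cons_ne_nil _ _

theorem mul_of_ne_one (x : X) (w : FreeMonoid X) : w * FreeMonoid.of x ≠ 1 := fun h =>
  List.cons_ne_nil _ _ (List.append_eq_nil_iff.1 h).2

theorem coeff_smul_one_of_ne (c : K) {w : FreeMonoid X} (hw : w ≠ 1) :
    (c • (1 : MonoidAlgebra K (FreeMonoid X))).coeff w = 0 := by
  rw [coeff_smul_apply, one_def, coeff_single, Finsupp.single_eq_of_ne hw, smul_zero]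

variable [Fintype X]

/-- Together with `ld_sum_gen_mul`: the augmentation ideal is a free right module on the generators,
with coordinates `ld x`. The `rd` versions give freeness as a left module. -/
theorem eq_add_sum_gen_mul (r : MonoidAlgebra K (FreeMonoid X)) :
    r = r.coeff 1 • 1 + ∑ x, gen x * ld x r := by
  ext w
  rw [coeff_add, Finsupp.add_apply, coeff_sum, Finsupp.finsetSum_apply]
  rcases eq_one_or_eq_of_mul w with rfl | ⟨x, v, rfl⟩
  · simp [coeff_gen_mul_one]
  · rw [coeff_smul_one_of_ne _ (of_mul_ne_one _ _), zero_add,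
      Finset.sum_eq_single x (fun y _ hy => coeff_gen_mul_of_ne hy.symm _ _) (by simp),
      coeff_gen_mul_of_mul, coeff_ld]

theorem eq_add_sum_mul_gen (r : MonoidAlgebra K (FreeMonoid X)) :
    r = r.coeff 1 • 1 + ∑ x, rd x r * gen x := by
  ext w
  rw [coeff_add, Finsupp.add_apply, coeff_sum, Finsupp.finsetSum_apply]
  rcases eq_one_or_eq_mul_of w with rfl | ⟨v, x, rfl⟩
  · simp [coeff_mul_gen_one]
  · rw [coeff_smul_one_of_ne _ (mul_of_ne_one _ _), zero_add,
      Finset.sum_eq_single x (fun y _ hy => coeff_mul_gen_of_ne hy.symm _ _) (by simp),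
      coeff_mul_gen_mul_of, coeff_rd]

theorem ld_sum_gen_mul (x : X) (t : X → MonoidAlgebra K (FreeMonoid X)) :
    ld x (∑ y, gen y * t y) = t x := by
  rw [map_sum, Finset.sum_eq_single x (fun y _ hy => ld_gen_mul_of_ne hy.symm _) (by simp),
    ld_gen_mul_self]

theorem rd_sum_mul_gen (x : X) (t : X → MonoidAlgebra K (FreeMonoid X)) :
    rd x (∑ y, t y * gen y) = t x := by
  rw [map_sum, Finset.sum_eq_single x (fun y _ hy => rd_mul_gen_of_ne hy.symm _) (by simp),
    rd_mul_gen_self]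

theorem ld_mul (x : X) (n v : MonoidAlgebra K (FreeMonoid X)) :
    ld x (n * v) = n.coeff 1 • ld x v + ld x n * v := by
  conv_lhs => rw [eq_add_sum_gen_mul n]
  rw [add_mul, Finset.sum_mul, map_add, smul_mul_assoc, one_mul, map_smul]
  simp only [mul_assoc]
  rw [ld_sum_gen_mul]

end FreeWords

/-! ### Degree filtration and finitely generated submodules over the free algebra. -/

namespace FreeWords

open MonoidAlgebra

variable {K : Type*} [Field K] {X : Type*}

variable (K X) in
/-- The elements of the free algebra of degree less than `m`. -/
noncomputable def degLT (m : ℕ) : Submodule K (MonoidAlgebra K (FreeMonoid X)) where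
  carrier := {r | ∀ w : FreeMonoid X, m ≤ w.length → r.coeff w = 0}
  add_mem' {r s} hr hs w hw := by rw [coeff_add, Finsupp.add_apply, hr w hw, hs w hw, add_zero]
  zero_mem' _ _ := rfl
  smul_mem' c r hr w hw := by rw [coeff_smul_apply, hr w hw, smul_zero]

theorem degLT_mono {m n : ℕ} (h : m ≤ n) : degLT K X m ≤ degLT K X n :=
  fun _ hr w hw => hr w (h.trans hw)

theorem exists_mem_degLT (r : MonoidAlgebra K (FreeMonoid X)) : ∃ m, r ∈ degLT K X m := by
  refine ⟨(r.coeff.support.sup fun w => w.length) + 1, fun w hw => ?_⟩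
  by_contra h
  have := Finset.le_sup (f := fun w : FreeMonoid X => w.length) (Finsupp.mem_support_iff.2 h)
  omega

theorem ld_mem_degLT (x : X) {m : ℕ} {r : MonoidAlgebra K (FreeMonoid X)}
    (hr : r ∈ degLT K X (m + 1)) : ld x r ∈ degLT K X m := by
  intro w hw
  rw [coeff_ld]
  apply hr
  rw [FreeMonoid.length_mul, FreeMonoid.length_of]
  omega

theorem gen_mul_mem_degLT (x : X) {m : ℕ} {r : MonoidAlgebra K (FreeMonoid X)}
    (hr : r ∈ degLT K X m) : gen x * r ∈ degLT K X (m + 1) := by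
  intro w hw
  rcases eq_one_or_eq_of_mul w with rfl | ⟨y, v, rfl⟩
  · exact coeff_gen_mul_one _ _
  · rw [FreeMonoid.length_mul, FreeMonoid.length_of] at hw
    rcases eq_or_ne y x with rfl | h
    · rw [coeff_gen_mul_of_mul]
      exact hr v (by omega)
    · exact coeff_gen_mul_of_ne h _ _

theorem finite_degLT [Finite X] (m : ℕ) : Module.Finite K (degLT K X m) := by
  have hfin : {w : FreeMonoid X | w.length < m}.Finite := List.finite_length_lt X m
  have := hfin.to_subtype
  let f : degLT K X m →ₗ[K] ({w : FreeMonoid X | w.length < m} → K) :=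
    { toFun := fun r w => r.1.coeff w
      map_add' := fun _ _ => rfl
      map_smul' := fun _ _ => rfl }
  refine Module.Finite.of_injective f fun r s h => ?_
  ext w
  by_cases hw : w.length < m
  · exact congrFun h ⟨w, hw⟩
  · rw [r.2 w (not_lt.1 hw), s.2 w (not_lt.1 hw)]

theorem exists_leading {n : MonoidAlgebra K (FreeMonoid X)} (hn : n ≠ 0) :
    ∃ u : FreeMonoid X, n.coeff u ≠ 0 ∧ n ∈ degLT K X (u.length + 1) := by
  have hne : n.coeff.support.Nonempty := by
    rw [Finsupp.support_nonempty_iff]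
    exact fun h => hn (coeff_eq_zero.1 h)
  obtain ⟨u, hu, hmax⟩ := n.coeff.support.exists_max_image (fun w => w.length) hne
  refine ⟨u, Finsupp.mem_support_iff.1 hu, fun w hw => ?_⟩
  by_contra h
  have := hmax w (Finsupp.mem_support_iff.2 h)
  omega

section Vector

variable {a : Type*}

variable (K X a) in
/-- The vectors all of whose coordinates have degree less than `m`. -/
noncomputable def vecDegLT (m : ℕ) : Submodule K (a → MonoidAlgebra K (FreeMonoid X)) :=
  Submodule.pi Set.univ fun _ => degLT K X m

theorem mem_vecDegLT {m : ℕ} {v : a → MonoidAlgebra K (FreeMonoid X)} :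
    v ∈ vecDegLT K X a m ↔ ∀ i, v i ∈ degLT K X m := by
  simp [vecDegLT]

theorem vecDegLT_mono {m n : ℕ} (h : m ≤ n) : vecDegLT K X a m ≤ vecDegLT K X a n :=
  fun _ hv => mem_vecDegLT.2 fun i => degLT_mono h (mem_vecDegLT.1 hv i)

theorem exists_mem_vecDegLT [Finite a] (v : a → MonoidAlgebra K (FreeMonoid X)) :
    ∃ m, v ∈ vecDegLT K X a m := by
  have := Fintype.ofFinite a
  choose m hm using fun i => exists_mem_degLT (v i)
  exact ⟨Finset.univ.sup m, mem_vecDegLT.2 fun i =>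
    degLT_mono (Finset.le_sup (Finset.mem_univ i)) (hm i)⟩

theorem finite_vecDegLT [Finite X] [Finite a] (m : ℕ) :
    Module.Finite K (vecDegLT K X a m) := by
  have := finite_degLT (K := K) (X := X) m
  let f : vecDegLT K X a m →ₗ[K] (a → degLT K X m) :=
    { toFun := fun v i => ⟨v.1 i, mem_vecDegLT.1 v.2 i⟩
      map_add' := fun _ _ => rfl
      map_smul' := fun _ _ => rfl }
  refine Module.Finite.of_injective f fun v w h => ?_
  ext i : 2
  exact congrArg Subtype.val (congrFun h i)

/-- The coordinatewise extension of `ld`. -/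
noncomputable def vld (x : X) : (a → MonoidAlgebra K (FreeMonoid X)) →ₗ[K]
    (a → MonoidAlgebra K (FreeMonoid X)) :=
  LinearMap.pi fun i => ld x ∘ₗ LinearMap.proj i

theorem vld_apply (x : X) (v : a → MonoidAlgebra K (FreeMonoid X)) (i : a) :
    vld x v i = ld x (v i) := rfl

theorem vld_mem (x : X) {m : ℕ} {v : a → MonoidAlgebra K (FreeMonoid X)}
    (hv : v ∈ vecDegLT K X a (m + 1)) : vld x v ∈ vecDegLT K X a m :=
  mem_vecDegLT.2 fun i => ld_mem_degLT x (mem_vecDegLT.1 hv i)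

theorem gen_smul_mem (x : X) {m : ℕ} {v : a → MonoidAlgebra K (FreeMonoid X)}
    (hv : v ∈ vecDegLT K X a m) : (gen x : MonoidAlgebra K (FreeMonoid X)) • v ∈
      vecDegLT K X a (m + 1) :=
  mem_vecDegLT.2 fun i => gen_mul_mem_degLT x (mem_vecDegLT.1 hv i)

variable [Fintype X]

theorem vld_sum_gen_smul (x : X) (t : X → a → MonoidAlgebra K (FreeMonoid X)) :
    vld x (∑ y, (gen y : MonoidAlgebra K (FreeMonoid X)) • t y) = t x := by
  ext1 i
  rw [vld_apply, Finset.sum_apply]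
  exact ld_sum_gen_mul x fun y => t y i

theorem vld_smul (x : X) (n : MonoidAlgebra K (FreeMonoid X))
    (v : a → MonoidAlgebra K (FreeMonoid X)) :
    vld x (n • v) = n.coeff 1 • vld x v + ld x n • v := by
  ext1 i
  exact ld_mul x n (v i)

/-- Successive iterates of the span of a space under multiplication by generators. -/
noncomputable def genSpan (E : Submodule K (a → MonoidAlgebra K (FreeMonoid X))) :
    ℕ → Submodule K (a → MonoidAlgebra K (FreeMonoid X))
  | 0 => E
  | n + 1 =>
    { carrier := {y | ∃ s ∈ genSpan E n, ∃ t : X → a → MonoidAlgebra K (FreeMonoid X),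
        (∀ x, t x ∈ genSpan E n) ∧ y = s + ∑ x, (gen x : MonoidAlgebra K (FreeMonoid X)) • t x}
      add_mem' := by
        rintro _ _ ⟨s, hs, t, ht, rfl⟩ ⟨s', hs', t', ht', rfl⟩
        refine ⟨s + s', add_mem hs hs', t + t', fun x => add_mem (ht x) (ht' x), ?_⟩
        simp only [Pi.add_apply, smul_add, Finset.sum_add_distrib]
        abel
      zero_mem' := ⟨0, zero_mem _, 0, fun _ => zero_mem _, by simp⟩
      smul_mem' := by
        rintro c _ ⟨s, hs, t, ht, rfl⟩
        refine ⟨c • s, Submodule.smul_mem _ c hs, fun x => c • t x,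
          fun x => Submodule.smul_mem _ c (ht x), ?_⟩
        rw [smul_add, Finset.smul_sum]
        congr 1
        exact Finset.sum_congr rfl fun x _ => (smul_comm _ _ _) }

theorem mem_genSpan_succ {E : Submodule K (a → MonoidAlgebra K (FreeMonoid X))} {n : ℕ}
    {y : a → MonoidAlgebra K (FreeMonoid X)} : y ∈ genSpan E (n + 1) ↔
      ∃ s ∈ genSpan E n, ∃ t : X → a → MonoidAlgebra K (FreeMonoid X),
        (∀ x, t x ∈ genSpan E n) ∧ y = s + ∑ x, (gen x : MonoidAlgebra K (FreeMonoid X)) • t x :=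
  Iff.rfl

theorem genSpan_mono (E : Submodule K (a → MonoidAlgebra K (FreeMonoid X))) {n m : ℕ}
    (h : n ≤ m) : genSpan E n ≤ genSpan E m := by
  induction m, h using Nat.le_induction with
  | base => exact le_rfl
  | succ k _ ih =>
    exact fun y hy => mem_genSpan_succ.2 ⟨y, ih hy, 0, fun _ => zero_mem _, by simp⟩

theorem gen_smul_mem_genSpan {E : Submodule K (a → MonoidAlgebra K (FreeMonoid X))} {n : ℕ}
    (x : X) {y : a → MonoidAlgebra K (FreeMonoid X)} (hy : y ∈ genSpan E n) :
    (gen x : MonoidAlgebra K (FreeMonoid X)) • y ∈ genSpan E (n + 1) := by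
  classical
  refine mem_genSpan_succ.2 ⟨0, zero_mem _, Pi.single x y, fun z => ?_, ?_⟩
  · rcases eq_or_ne z x with rfl | h
    · simpa using hy
    · simp [Pi.single_eq_of_ne h]
  · rw [zero_add, Finset.sum_eq_single x (fun z _ hz => by simp [Pi.single_eq_of_ne hz]) (by simp)]
    simp

theorem smul_mem_of_gen_smul_mem {V : Type*} [AddCommGroup V] [Module K V]
    [Module (MonoidAlgebra K (FreeMonoid X)) V] [IsScalarTower K (MonoidAlgebra K (FreeMonoid X)) V]
    (N : Submodule K V)
    (h : ∀ (x : X), ∀ v ∈ N, (gen x : MonoidAlgebra K (FreeMonoid X)) • v ∈ N)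
    (r : MonoidAlgebra K (FreeMonoid X)) {v : V} (hv : v ∈ N) : r • v ∈ N := by
  obtain ⟨m, hm⟩ := exists_mem_degLT r
  induction m generalizing r with
  | zero =>
    have : r = 0 := by ext w; exact hm w (Nat.zero_le _)
    rw [this, zero_smul]; exact zero_mem _
  | succ m ih =>
    rw [eq_add_sum_gen_mul r, add_smul, Finset.sum_smul]
    refine add_mem ?_ (Submodule.sum_mem _ fun x _ => ?_)
    · rw [smul_assoc, one_smul]; exact N.smul_mem _ hv
    · rw [mul_smul]; exact h x _ (ih _ (ld_mem_degLT x hm))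

variable (S : Submodule (MonoidAlgebra K (FreeMonoid X)) (a → MonoidAlgebra K (FreeMonoid X)))

theorem genSpan_le {E : Submodule K (a → MonoidAlgebra K (FreeMonoid X))}
    (hE : E ≤ S.restrictScalars K) (n : ℕ) : genSpan E n ≤ S.restrictScalars K := by
  induction n with
  | zero => exact hE
  | succ n ih =>
    rintro _ ⟨s, hs, t, ht, rfl⟩
    exact add_mem (ih hs) (Submodule.sum_mem _ fun x _ => S.smul_mem _ (ih (ht x)))

theorem genSpan_le_vecDegLT {E : Submodule K (a → MonoidAlgebra K (FreeMonoid X))} {D : ℕ}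
    (hE : E ≤ vecDegLT K X a D) (n : ℕ) : genSpan E n ≤ vecDegLT K X a (D + n) := by
  induction n with
  | zero => exact hE
  | succ n ih =>
    rintro _ ⟨s, hs, t, ht, rfl⟩
    exact add_mem (vecDegLT_mono (by omega) (ih hs))
      (Submodule.sum_mem _ fun x _ => gen_smul_mem x (ih (ht x)))

/-- Distinct initial letters cannot cancel: if `∑ gen x • t x` has small degree, so does every `t
x`. Hence elements of small degree are reached in few steps. -/
theorem genSpan_inf_le {E : Submodule K (a → MonoidAlgebra K (FreeMonoid X))} {D : ℕ}
    (hE : E = S.restrictScalars K ⊓ vecDegLT K X a D) (n : ℕ) :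
    genSpan E (n + 1) ⊓ vecDegLT K X a (D + n) ≤ genSpan E n := by
  have hE1 : E ≤ S.restrictScalars K := hE ▸ inf_le_left
  have hE2 : E ≤ vecDegLT K X a D := hE ▸ inf_le_right
  induction n with
  | zero =>
    intro y hy
    change y ∈ E
    rw [hE]
    exact ⟨genSpan_le S hE1 _ hy.1, hy.2⟩
  | succ n ih =>
    rintro _ ⟨⟨s, hs, t, ht, rfl⟩, hy⟩
    have hsum : (∑ x, (gen x : MonoidAlgebra K (FreeMonoid X)) • t x) ∈
        vecDegLT K X a (D + n + 1) :=
      (Submodule.add_mem_iff_right _ (genSpan_le_vecDegLT hE2 (n + 1) hs)).1 hy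
    refine add_mem hs (Submodule.sum_mem _ fun x _ => gen_smul_mem_genSpan x (ih ⟨ht x, ?_⟩))
    rw [← vld_sum_gen_smul x t]
    exact vld_mem x hsum

theorem smul_mem_vecDegLT {k m : ℕ} {n : MonoidAlgebra K (FreeMonoid X)}
    (hn : n ∈ degLT K X (k + 1)) {v : a → MonoidAlgebra K (FreeMonoid X)}
    (hv : v ∈ vecDegLT K X a m) : n • v ∈ vecDegLT K X a (m + k) := by
  induction k generalizing n with
  | zero =>
    rw [eq_add_sum_gen_mul n, add_smul, Finset.sum_smul]
    refine add_mem ?_ (Submodule.sum_mem _ fun x _ => ?_)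
    · rw [smul_assoc, one_smul]; exact Submodule.smul_mem _ _ hv
    · have : ld x n = 0 := by ext w; exact ld_mem_degLT x hn w (Nat.zero_le _)
      rw [this, mul_zero, zero_smul]
      exact zero_mem _
  | succ k ih =>
    rw [eq_add_sum_gen_mul n, add_smul, Finset.sum_smul]
    refine add_mem ?_ (Submodule.sum_mem _ fun x _ => ?_)
    · rw [smul_assoc, one_smul]
      exact Submodule.smul_mem _ _ (vecDegLT_mono (by omega) hv)
    · rw [mul_smul]
      exact gen_smul_mem x (ih (ld_mem_degLT x hn))

/-- A finitely generated submodule of a finite free module over a free algebra that contains all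
multiples of the module by a fixed nonzero element has finite codimension. -/
theorem exists_sub_mem_vecDegLT [Finite a] (hS : S.FG) {n : MonoidAlgebra K (FreeMonoid X)}
    (hn : n ≠ 0) (hnS : ∀ v, n • v ∈ S) : ∃ D, ∀ v, ∃ s ∈ S, v - s ∈ vecDegLT K X a D := by
  obtain ⟨T, rfl⟩ := hS
  set S := Submodule.span (MonoidAlgebra K (FreeMonoid X)) (T : Set (a → MonoidAlgebra K (FreeMonoid X))) with hSdef
  choose deg hdeg using exists_mem_vecDegLT (K := K) (X := X) (a := a)
  -- `E` is all of `S` in degrees below `D`, not merely the span of the generators; `genSpan_inf_le`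
  -- needs this at its start.
  let D := T.sup deg
  let E := S.restrictScalars K ⊓ vecDegLT K X a D
  have hE1 : E ≤ S.restrictScalars K := inf_le_left
  have hE2 : E ≤ vecDegLT K X a D := inf_le_right
  have hdir : Directed (· ≤ ·) (genSpan E) :=
    (monotone_nat_of_le_succ fun n => genSpan_mono E (Nat.le_succ n)).directed_le
  have hunion : ∀ s ∈ S, ∃ k, s ∈ genSpan E k := by
    intro s hs
    rw [← Submodule.mem_iSup_of_directed _ hdir]
    induction hs using Submodule.span_induction with
    | mem y hy =>
      rw [Submodule.mem_iSup_of_directed _ hdir]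
      exact ⟨0, Submodule.subset_span hy, vecDegLT_mono (Finset.le_sup hy) (hdeg y)⟩
    | zero => exact zero_mem _
    | add y z _ _ hy hz => exact add_mem hy hz
    | smul r y _ hy =>
      refine smul_mem_of_gen_smul_mem _ (fun x v hv => ?_) r hy
      rw [Submodule.mem_iSup_of_directed _ hdir] at hv ⊢
      obtain ⟨k, hk⟩ := hv
      exact ⟨k + 1, gen_smul_mem_genSpan x hk⟩
  have hmem : ∀ (j : ℕ) (s : a → MonoidAlgebra K (FreeMonoid X)), s ∈ S →
      s ∈ vecDegLT K X a (D + j) → s ∈ genSpan E j := by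
    intro j s hs hsD
    obtain ⟨k, hk⟩ := hunion s hs
    have hk' := genSpan_mono E (Nat.le_add_left k j) hk
    clear hk
    induction k with
    | zero => exact hk'
    | succ k ih =>
      exact ih (genSpan_inf_le S rfl (j + k) ⟨hk', vecDegLT_mono (by omega) hsD⟩)
  -- Membership in `G m` says that the component of degree `m` is the leading part of an element of
  -- `S`.
  let G : ℕ → Submodule K (a → MonoidAlgebra K (FreeMonoid X)) := fun m =>
    S.restrictScalars K ⊓ vecDegLT K X a (m + 1) ⊔ vecDegLT K X a m
  -- Above degree `D` an element of `S` is `∑ gen x • t x` with `t x ∈ S`, up to lower degree, so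
  -- stripping an initial letter leads back into `S`.
  have hG : ∀ m, D ≤ m → ∀ x, ∀ y ∈ G (m + 1), vld x y ∈ G m := by
    intro m hm x y hy
    obtain ⟨e, he, f, hf, rfl⟩ := Submodule.mem_sup.1 hy
    obtain ⟨j, rfl⟩ := Nat.exists_eq_add_of_le hm
    obtain ⟨s, hs, t, ht, rfl⟩ := mem_genSpan_succ.1 (hmem (j + 1 + 1) e he.1 he.2)
    rw [map_add, map_add, vld_sum_gen_smul]
    refine add_mem (add_mem ?_ ?_) ?_
    · exact Submodule.mem_sup_right (vld_mem x (genSpan_le_vecDegLT hE2 _ hs))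
    · exact Submodule.mem_sup_left ⟨genSpan_le S hE1 _ (ht x), genSpan_le_vecDegLT hE2 _ (ht x)⟩
    · exact Submodule.mem_sup_right (vld_mem x hf)
  -- The letters of a longest word `u` of `r` are stripped from `r • v` one by one. The other term
  -- of `vld_smul` has lower degree each time, and in the end a scalar multiple of `v` remains.
  have hlead : ∀ m, D ≤ m → ∀ v ∈ vecDegLT K X a (m + 1), ∀ (u : FreeMonoid X)
      (r : MonoidAlgebra K (FreeMonoid X)), r ∈ degLT K X (u.length + 1) →
      r • v ∈ G (m + u.length) → r.coeff u • v ∈ G m := by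
    intro m hm v hv u
    induction u using FreeMonoid.recOn with
    | one =>
      intro r hr hrv
      have : r = r.coeff 1 • 1 := by
        conv_lhs => rw [eq_add_sum_gen_mul r]
        rw [add_eq_left]
        refine Finset.sum_eq_zero fun x _ => ?_
        have : ld x r = 0 := by ext w; exact ld_mem_degLT x hr w (Nat.zero_le _)
        rw [this, mul_zero]
      rw [this, smul_assoc, one_smul] at hrv
      exact hrv
    | of_mul x u ih =>
      intro r hr hrv
      rw [FreeMonoid.length_mul, FreeMonoid.length_of, add_comm 1] at hr hrv
      have h1 := hG (m + u.length) (by omega) x _ hrv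
      rw [vld_smul] at h1
      have h2 : r.coeff 1 • vld x v ∈ G (m + u.length) :=
        Submodule.mem_sup_right (Submodule.smul_mem _ _
          (vecDegLT_mono (Nat.le_add_right _ _) (vld_mem x hv)))
      have h3 := (Submodule.add_mem_iff_right _ h2).1 h1
      exact ih (ld x r) (ld_mem_degLT x hr) h3
  obtain ⟨u, hu, hnu⟩ := exists_leading hn
  -- Thus every leading part in degree at least `D` comes from `S`, and vectors reduce modulo `S` to
  -- degree below `D`.
  have hstep : ∀ m, D ≤ m → ∀ v ∈ vecDegLT K X a (m + 1), v ∈ G m := by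
    intro m hm v hv
    have h := hlead m hm v hv u n hnu (Submodule.mem_sup_left ⟨hnS v, by
      have := smul_mem_vecDegLT hnu hv
      rwa [add_right_comm] at this⟩)
    exact ((G m).smul_mem_iff hu).1 h
  refine ⟨D, fun v => ?_⟩
  have hv := vecDegLT_mono (Nat.le_add_left (deg v) D) (hdeg v)
  generalize deg v = j at hv
  induction j generalizing v with
  | zero => exact ⟨0, zero_mem _, by simpa using hv⟩
  | succ j ih =>
    obtain ⟨s, hs, f, hf, rfl⟩ := Submodule.mem_sup.1 (hstep (D + j) (Nat.le_add_right _ _) v hv)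
    obtain ⟨s', hs', h'⟩ := ih f hf
    refine ⟨s + s', add_mem hs.1 hs', ?_⟩
    rwa [add_sub_add_left_eq_sub]

end Vector

end FreeWords

/-! ### Functoriality of enveloping algebras and the kernel of an induced map. -/

namespace UEAMap

attribute [local instance 100] LieRing.ofAssociativeRing

open UniversalEnvelopingAlgebra

variable {K : Type*} [Field K] {L F G : Type*} [LieRing L] [LieAlgebra K L]
  [LieRing F] [LieAlgebra K F] [LieRing G] [LieAlgebra K G]

/-- The map between enveloping algebras induced by a homomorphism of Lie algebras. -/
noncomputable def uMap (f : L →ₗ⁅K⁆ F) :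
    UniversalEnvelopingAlgebra K L →ₐ[K] UniversalEnvelopingAlgebra K F :=
  lift K ((ι K).comp f)

theorem uMap_ι (f : L →ₗ⁅K⁆ F) (x : L) : uMap f (ι K x) = ι K (f x) := lift_ι_apply K _ x

theorem uMap_surjective {f : L →ₗ⁅K⁆ F} (hf : Function.Surjective f) :
    Function.Surjective (uMap f) := by
  rw [← AlgHom.range_eq_top, eq_top_iff, ← PBW.adjoin_range_ι, Algebra.adjoin_le_iff]
  rintro _ ⟨y, rfl⟩
  obtain ⟨x, rfl⟩ := hf y
  exact ⟨ι K x, uMap_ι f x⟩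

theorem augmentation_ι (x : L) : LieAlgebra.augmentation K L (ι K x) = 0 :=
  lift_ι_apply K (0 : L →ₗ⁅K⁆ K) x

theorem augmentation_uMap (f : L →ₗ⁅K⁆ F) (u : UniversalEnvelopingAlgebra K L) :
    LieAlgebra.augmentation K F (uMap f u) = LieAlgebra.augmentation K L u := by
  have : (LieAlgebra.augmentation K F).comp (uMap f) = LieAlgebra.augmentation K L := by
    apply hom_ext
    ext x
    change LieAlgebra.augmentation K F (uMap f (ι K x)) = LieAlgebra.augmentation K L (ι K x)
    rw [uMap_ι, augmentation_ι, augmentation_ι]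
  exact DFunLike.congr_fun this u

/-- The right ideal generated by the kernel of a homomorphism of Lie algebras. -/
def kerSpan (f : L →ₗ⁅K⁆ F) : Submodule K (UniversalEnvelopingAlgebra K L) :=
  Submodule.span K {y | ∃ m c, f m = 0 ∧ y = ι K m * c}

/-- The kernel of `f` is an ideal of `L`, so commuting `x` past one of its elements only produces
another one. -/
theorem ι_mul_mem_kerSpan (f : L →ₗ⁅K⁆ F) (x : L) {y : UniversalEnvelopingAlgebra K L}
    (hy : y ∈ kerSpan f) : ι K x * y ∈ kerSpan f := by
  induction hy using Submodule.span_induction with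
  | mem y hy =>
    obtain ⟨m, c, hm, rfl⟩ := hy
    have : ι K x * (ι K m * c) = ι K m * (ι K x * c) + ι K ⁅x, m⁆ * c := by
      rw [LieHom.map_lie, LieRing.of_associative_ring_bracket]
      noncomm_ring
    rw [this]
    exact add_mem (Submodule.subset_span ⟨m, _, hm, rfl⟩)
      (Submodule.subset_span ⟨⁅x, m⁆, c, by rw [LieHom.map_lie, hm, lie_zero], rfl⟩)
  | zero => rw [mul_zero]; exact zero_mem _
  | add y z _ _ h1 h2 => rw [mul_add]; exact add_mem h1 h2
  | smul c y _ h => rw [mul_smul_comm]; exact Submodule.smul_mem _ c h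

/-- The action of `L` on the quotient of its enveloping algebra by `kerSpan f`. -/
noncomputable def kerSpanAct (f : L →ₗ⁅K⁆ F) :
    L →ₗ⁅K⁆ Module.End K (UniversalEnvelopingAlgebra K L ⧸ kerSpan f) where
  toFun x := (kerSpan f).mapQ (kerSpan f) (LinearMap.mulLeft K (ι K x))
    fun _ hy => ι_mul_mem_kerSpan f x hy
  map_add' x y := by
    refine Submodule.linearMap_qext _ (LinearMap.ext fun u => ?_)
    change (kerSpan f).mkQ (ι K (x + y) * u) =
      (kerSpan f).mkQ (ι K x * u) + (kerSpan f).mkQ (ι K y * u)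
    rw [map_add, add_mul, map_add]
  map_smul' c x := by
    refine Submodule.linearMap_qext _ (LinearMap.ext fun u => ?_)
    change (kerSpan f).mkQ (ι K (c • x) * u) = c • (kerSpan f).mkQ (ι K x * u)
    rw [map_smul, smul_mul_assoc, map_smul]
  map_lie' {x y} := by
    rw [LieRing.of_associative_ring_bracket]
    refine Submodule.linearMap_qext _ (LinearMap.ext fun u => ?_)
    change (kerSpan f).mkQ (ι K ⁅x, y⁆ * u) =
      (kerSpan f).mkQ (ι K x * (ι K y * u)) - (kerSpan f).mkQ (ι K y * (ι K x * u))
    rw [LieHom.map_lie, LieRing.of_associative_ring_bracket, sub_mul, map_sub,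
      mul_assoc, mul_assoc]

theorem kerSpanAct_mk (f : L →ₗ⁅K⁆ F) (x : L) (u : UniversalEnvelopingAlgebra K L) :
    kerSpanAct f x ((kerSpan f).mkQ u) = (kerSpan f).mkQ (ι K x * u) := rfl

theorem kerSpanAct_eq_zero (f : L →ₗ⁅K⁆ F) {m : L} (hm : f m = 0) : kerSpanAct f m = 0 := by
  refine Submodule.linearMap_qext _ (LinearMap.ext fun u => ?_)
  change (kerSpan f).mkQ (ι K m * u) = 0
  rw [Submodule.mkQ_apply, Submodule.Quotient.mk_eq_zero]
  exact Submodule.subset_span ⟨m, u, hm, rfl⟩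

/-- A homomorphism of Lie algebras factors through a surjective one with smaller kernel. -/
theorem exists_factor {f : L →ₗ⁅K⁆ F} (hf : Function.Surjective f) (g : L →ₗ⁅K⁆ G)
    (h : ∀ m, f m = 0 → g m = 0) : ∃ k : F →ₗ⁅K⁆ G, ∀ x, k (f x) = g x := by
  have key : ∀ x y, f x = f y → g x = g y := fun x y hxy => by
    rw [← sub_eq_zero, ← map_sub]
    exact h _ (by rw [map_sub, hxy, sub_self])
  have hs := Function.surjInv_eq hf
  exact ⟨{
    toFun := fun y => g (Function.surjInv hf y)
    map_add' := fun x y => by rw [← map_add]; apply key; simp only [map_add, hs]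
    map_smul' := fun c x => by
      rw [RingHom.id_apply, ← map_smul]; apply key; simp only [map_smul, hs]
    map_lie' := fun {x y} => by rw [← LieHom.map_lie]; apply key; simp only [LieHom.map_lie, hs] },
    fun x => key _ _ (hs _)⟩

/-- The kernel of `f` acts as zero on `U(L) / kerSpan f`, so the action of `U(L)` factors through
`uMap f`. An element `u` killed by `uMap f` thus acts as zero, while it sends the class of `1` to
the class of `u`. -/
theorem mem_kerSpan_of_uMap_eq_zero {f : L →ₗ⁅K⁆ F} (hf : Function.Surjective f)
    {u : UniversalEnvelopingAlgebra K L} (hu : uMap f u = 0) : u ∈ kerSpan f := by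
  obtain ⟨k, hk⟩ := exists_factor hf (kerSpanAct f) fun m hm => kerSpanAct_eq_zero f hm
  have h1 : (lift K k).comp (uMap f) = lift K (kerSpanAct f) := by
    apply hom_ext
    ext1 x
    change lift K k (uMap f (ι K x)) = lift K (kerSpanAct f) (ι K x)
    rw [uMap_ι, lift_ι_apply, lift_ι_apply, hk]
  have h2 := PBW.smul_mem_of_ι_smul_mem
    (LinearMap.eqLocus ((LinearMap.applyₗ ((kerSpan f).mkQ (1 : UniversalEnvelopingAlgebra K L)))
      ∘ₗ (lift K (kerSpanAct f)).toLinearMap) (kerSpan f).mkQ) (fun x v hv => by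
      rw [LinearMap.mem_eqLocus] at hv ⊢
      change lift K (kerSpanAct f) v ((kerSpan f).mkQ 1) = (kerSpan f).mkQ v at hv
      change lift K (kerSpanAct f) (ι K x * v) ((kerSpan f).mkQ 1) =
        (kerSpan f).mkQ (ι K x * v)
      rw [map_mul, Module.End.mul_apply, hv, lift_ι_apply, kerSpanAct_mk]) u (v := 1) (by
      rw [LinearMap.mem_eqLocus]
      change lift K (kerSpanAct f) 1 ((kerSpan f).mkQ 1) = (kerSpan f).mkQ 1
      rw [map_one (lift K (kerSpanAct f))]
      rfl)
  rw [smul_eq_mul, mul_one, LinearMap.mem_eqLocus] at h2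
  change lift K (kerSpanAct f) u ((kerSpan f).mkQ 1) = (kerSpan f).mkQ u at h2
  rw [← h1, AlgHom.comp_apply, hu, map_zero, LinearMap.zero_apply, eq_comm, Submodule.mkQ_apply,
    Submodule.Quotient.mk_eq_zero] at h2
  exact h2

end UEAMap

/-! ### The enveloping algebra of a free Lie algebra as a free associative algebra. -/

namespace FreeWords

attribute [local instance 100] LieRing.ofAssociativeRing

open MonoidAlgebra UEAMap

variable {K : Type*} [Field K] {F X : Type*} [LieRing F] [LieAlgebra K F]

/-- The enveloping algebra of a free Lie algebra is a free associative algebra. -/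
noncomputable def freeEquiv (e : F ≃ₗ⁅K⁆ FreeLieAlgebra K X) :
    UniversalEnvelopingAlgebra K F ≃ₐ[K] MonoidAlgebra K (FreeMonoid X) :=
  ((AlgEquiv.ofAlgHom (uMap e.toLieHom) (uMap e.symm.toLieHom)
    (by
      apply UniversalEnvelopingAlgebra.hom_ext
      ext x
      change uMap e.toLieHom (uMap e.symm.toLieHom (UniversalEnvelopingAlgebra.ι K _)) = _
      rw [uMap_ι, uMap_ι]
      exact congrArg _ (e.apply_symm_apply _))
    (by
      apply UniversalEnvelopingAlgebra.hom_ext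
      ext x
      change uMap e.symm.toLieHom (uMap e.toLieHom (UniversalEnvelopingAlgebra.ι K _)) = _
      rw [uMap_ι, uMap_ι]
      exact congrArg _ (e.symm_apply_apply _))).trans
    (FreeLieAlgebra.universalEnvelopingEquivFreeAlgebra K X)).trans
    FreeAlgebra.equivMonoidAlgebraFreeMonoid

theorem freeEquiv_ι (e : F ≃ₗ⁅K⁆ FreeLieAlgebra K X) (x : X) :
    freeEquiv e (UniversalEnvelopingAlgebra.ι K (e.symm (FreeLieAlgebra.of K x))) = gen x := by
  change FreeAlgebra.equivMonoidAlgebraFreeMonoid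
    (FreeLieAlgebra.universalEnvelopingEquivFreeAlgebra K X (uMap e.toLieHom
      (UniversalEnvelopingAlgebra.ι K (e.symm (FreeLieAlgebra.of K x))))) = gen x
  rw [uMap_ι]
  have : e.toLieHom (e.symm (FreeLieAlgebra.of K x)) = FreeLieAlgebra.of K x :=
    e.apply_symm_apply _
  rw [this]
  have : FreeLieAlgebra.universalEnvelopingEquivFreeAlgebra K X
      (UniversalEnvelopingAlgebra.ι K (FreeLieAlgebra.of K x)) = FreeAlgebra.ι K x := by
    change UniversalEnvelopingAlgebra.lift K (FreeLieAlgebra.lift K (FreeAlgebra.ι K))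
      (UniversalEnvelopingAlgebra.ι K (FreeLieAlgebra.of K x)) = _
    rw [UniversalEnvelopingAlgebra.lift_ι_apply, FreeLieAlgebra.lift_of_apply]
  rw [this]
  change FreeAlgebra.lift K _ (FreeAlgebra.ι K x) = _
  rw [FreeAlgebra.lift_ι_apply]
  rfl

theorem augmentation_eq_coeff [Fintype X] (e : F ≃ₗ⁅K⁆ FreeLieAlgebra K X)
    (u : UniversalEnvelopingAlgebra K F) :
    LieAlgebra.augmentation K F u = (freeEquiv e u).coeff 1 := by
  obtain ⟨r, rfl⟩ := (freeEquiv e).symm.surjective u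
  rw [AlgEquiv.apply_symm_apply]
  have hgen : ∀ x, (freeEquiv e).symm (gen x) =
      UniversalEnvelopingAlgebra.ι K (e.symm (FreeLieAlgebra.of K x)) := fun x => by
    rw [← freeEquiv_ι e, AlgEquiv.symm_apply_apply]
  conv_lhs => rw [eq_add_sum_gen_mul r]
  simp only [map_add, map_sum, map_mul, map_smul, hgen, augmentation_ι, zero_mul, map_one,
    Finset.sum_const_zero, add_zero, smul_eq_mul, mul_one]

/-- A free Lie algebra that is finitely generated is free on a finite set. -/
theorem finite_of_isFGLie (e : F ≃ₗ⁅K⁆ FreeLieAlgebra K X) (h : LieAlgebra.IsFGLie K F) :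
    Finite X := by
  obtain ⟨S, hS, hspan⟩ := h
  -- The polynomial ring is commutative, so brackets map to zero and the image of `F` is spanned by
  -- the images of `S`. It contains the independent variables.
  let f : F →ₗ⁅K⁆ MvPolynomial X K :=
    (FreeLieAlgebra.lift K (MvPolynomial.X (R := K) : X → MvPolynomial X K)).comp e.toLieHom
  have hf : ∀ x, f (e.symm (FreeLieAlgebra.of K x)) = MvPolynomial.X x := fun x => by
    change FreeLieAlgebra.lift K (MvPolynomial.X : X → MvPolynomial X K) (e (e.symm (FreeLieAlgebra.of K x))) = _
    rw [LieEquiv.apply_symm_apply, FreeLieAlgebra.lift_of_apply]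
  let W : Submodule K (MvPolynomial X K) := Submodule.span K (f '' S)
  have hW : Module.Finite K W := Module.Finite.span_of_finite K (hS.image f)
  let N : LieSubalgebra K F :=
    { W.comap f.toLinearMap with
      lie_mem' := fun {x y} _ _ => by
        change f ⁅x, y⁆ ∈ W
        rw [LieHom.map_lie, LieRing.of_associative_ring_bracket, mul_comm, sub_self]
        exact zero_mem _ }
  have hN : N = ⊤ := by
    rw [eq_top_iff, ← hspan, LieSubalgebra.lieSpan_le]
    exact fun x hx => Submodule.subset_span ⟨x, hx, rfl⟩
  have hmem : ∀ x : X, (MvPolynomial.X x : MvPolynomial X K) ∈ W := fun x => by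
    have : e.symm (FreeLieAlgebra.of K x) ∈ N := by rw [hN]; trivial
    rw [← hf]
    exact this
  have hli : LinearIndependent K (fun x : X => (⟨MvPolynomial.X x, hmem x⟩ : W)) := by
    apply LinearIndependent.of_comp W.subtype
    exact MvPolynomial.linearIndependent_X X K
  exact hli.finite

end FreeWords

/-! ### Schanuel's lemma and finite presentation of the augmentation kernel. -/

namespace ModuleProjRes

/-- The common middle term in Schanuel's lemma transfers finite presentation. -/
theorem finitePresentation_of_exact_pair {R : Type*} [Ring R] {N Z P Q W : Type*}
    [AddCommGroup N] [Module R N] [AddCommGroup Z] [Module R Z] [AddCommGroup P] [Module R P]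
    [AddCommGroup Q] [Module R Q] [AddCommGroup W] [Module R W]
    [Module.FinitePresentation R N] [Module.FinitePresentation R Q] [Module.Projective R P]
    (i : N →ₗ[R] Z) (q : Z →ₗ[R] Q) (hi : Function.Injective i) (hq : Function.Surjective q)
    (hiq : Function.Exact i q) (j : W →ₗ[R] Z) (p : Z →ₗ[R] P) (hj : Function.Injective j)
    (hp : Function.Surjective p) (hjp : Function.Exact j p) : Module.FinitePresentation R W := by
  let i' : N →ₗ[R] LinearMap.ker q := i.codRestrict _ fun x => (hiq (i x)).2 ⟨x, rfl⟩
  have hi' : Function.Surjective i' := fun ⟨y, hy⟩ => by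
    obtain ⟨x, rfl⟩ := (hiq y).1 hy
    exact ⟨x, rfl⟩
  have hker : LinearMap.ker i' = ⊥ := LinearMap.ker_eq_bot.2 fun x y hxy =>
    hi (congrArg Subtype.val hxy)
  have : Module.FinitePresentation R (LinearMap.ker q) :=
    Module.finitePresentation_of_surjective i' hi' (by rw [hker]; exact Submodule.fg_bot)
  have : Module.FinitePresentation R Z := Module.finitePresentation_of_ker q hq
  exact Module.finitePresentation_of_projective_of_exact j p hj hp hjp

variable {R : Type u} [Ring R] {M : Type w} [AddCommGroup M] [Module R M]

/-- Over a module of type `FP_2` the kernel of a surjection from a finitely generated projective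
module is finitely presented. -/
theorem finitePresentation_ker (C : ModuleProjRes R M) (h : ∀ i, i ≤ 2 → Module.Finite R (C.P i))
    {Q : Type*} [AddCommGroup Q] [Module R Q] [Module.Finite R Q] [Module.Projective R Q]
    (f : Q →ₗ[R] M) (hf : Function.Surjective f) :
    Module.FinitePresentation R (LinearMap.ker f) := by
  have := C.projective 0
  have := C.projective 1
  have := h 0 (by omega)
  have := h 1 (by omega)
  have := h 2 le_rfl
  have hP1 : Module.FinitePresentation R (C.P 1) := Module.finitePresentation_of_projective R _
  have hQ : Module.FinitePresentation R Q := Module.finitePresentation_of_projective R _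
  let d₀ : C.P 1 →ₗ[R] LinearMap.ker C.ε :=
    (C.d 0).codRestrict _ fun x => (C.exact_zero (C.d 0 x)).2 ⟨x, rfl⟩
  have hd₀ : Function.Surjective d₀ := fun ⟨y, hy⟩ => by
    obtain ⟨x, rfl⟩ := (C.exact_zero y).1 hy
    exact ⟨x, rfl⟩
  have hker : (LinearMap.ker d₀).FG := by
    have : LinearMap.ker d₀ = LinearMap.range (C.d 1) := by
      ext x
      rw [LinearMap.mem_ker, ← (C.exact_succ 0).linearMap_ker_eq, LinearMap.mem_ker]
      exact Subtype.ext_iff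
    rw [this]
    exact Submodule.fg_range _
  have hΩ : Module.FinitePresentation R (LinearMap.ker C.ε) :=
    Module.finitePresentation_of_surjective d₀ hd₀ hker
  -- The fibre product over `M` is an extension of `Q` by `ker ε` and an extension of `P 0` by `ker
  -- f`.
  let Z : Submodule R (C.P 0 × Q) :=
    LinearMap.eqLocus (C.ε ∘ₗ LinearMap.fst R _ _) (f ∘ₗ LinearMap.snd R _ _)
  have hZ : ∀ z : Z, C.ε z.1.1 = f z.1.2 := fun z => z.2
  let p : Z →ₗ[R] C.P 0 := LinearMap.fst R _ _ ∘ₗ Z.subtype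
  let q : Z →ₗ[R] Q := LinearMap.snd R _ _ ∘ₗ Z.subtype
  have hp : Function.Surjective p := fun x => by
    obtain ⟨y, hy⟩ := hf (C.ε x)
    exact ⟨⟨(x, y), hy.symm⟩, rfl⟩
  have hq : Function.Surjective q := fun y => by
    obtain ⟨x, hx⟩ := C.ε_surjective (f y)
    exact ⟨⟨(x, y), hx⟩, rfl⟩
  let i : LinearMap.ker C.ε →ₗ[R] Z :=
    { toFun := fun x => ⟨(x.1, 0), by
        change C.ε x.1 = f 0
        rw [map_zero]; exact x.2⟩
      map_add' := fun x y => by ext <;> simp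
      map_smul' := fun c x => by ext <;> simp }
  let j : LinearMap.ker f →ₗ[R] Z :=
    { toFun := fun y => ⟨(0, y.1), by
        change C.ε 0 = f y.1
        rw [map_zero]; exact y.2.symm⟩
      map_add' := fun x y => by ext <;> simp
      map_smul' := fun c x => by ext <;> simp }
  refine finitePresentation_of_exact_pair i q (fun x y hxy => ?_) hq ?_ j p
    (fun x y hxy => ?_) hp ?_
  · exact Subtype.ext (congrArg (fun z : Z => z.1.1) hxy)
  · rintro ⟨⟨x, y⟩, hxy⟩
    have hxy' : C.ε x = f y := hxy
    constructor
    · intro hy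
      have hy' : y = 0 := hy
      subst hy'
      exact ⟨⟨x, by rw [LinearMap.mem_ker, hxy', map_zero]⟩, rfl⟩
    · rintro ⟨x', hx'⟩
      exact congrArg (fun z : Z => z.1.2) hx'.symm
  · exact Subtype.ext (congrArg (fun z : Z => z.1.2) hxy)
  · rintro ⟨⟨x, y⟩, hxy⟩
    have hxy' : C.ε x = f y := hxy
    constructor
    · intro hx
      have hx' : x = 0 := hx
      subst hx'
      exact ⟨⟨y, by rw [LinearMap.mem_ker, ← hxy', map_zero]⟩, rfl⟩
    · rintro ⟨y', hy'⟩
      exact congrArg (fun z : Z => z.1.1) hy'.symm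

end ModuleProjRes

/-! ### Finite codimension of `J * Δ` in `J`. -/

namespace FreeWords

open MonoidAlgebra

section FiniteCodim

variable {K V : Type*} [Field K] [AddCommGroup V] [Module K V]

/-- A complement of `J ⊓ N` in `J` embeds into the image of `B` modulo `N`. -/
theorem exists_finite_le_sup {J N N' B : Submodule K V} [FiniteDimensional K B] (hJ : J ≤ B ⊔ N)
    (hJN : J ⊓ N ≤ N') : ∃ B' : Submodule K V, FiniteDimensional K B' ∧ J ≤ B' ⊔ N' := by
  obtain ⟨C, hC⟩ := Submodule.exists_isCompl ((J ⊓ N).comap J.subtype)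
  refine ⟨C.map J.subtype, ?_, ?_⟩
  · have : FiniteDimensional K (B.map N.mkQ) := inferInstance
    have hfin : FiniteDimensional K C := by
      let g : C →ₗ[K] B.map N.mkQ := (N.mkQ ∘ₗ J.subtype ∘ₗ C.subtype).codRestrict _ fun c => by
        obtain ⟨b, hb, n, hn, h⟩ := Submodule.mem_sup.1 (hJ c.1.2)
        refine ⟨b, hb, ?_⟩
        change N.mkQ b = N.mkQ (c.1 : V)
        rw [← h, map_add, (Submodule.Quotient.mk_eq_zero N).2 hn |> fun h => (h : N.mkQ n = 0),
          add_zero]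
      refine Module.Finite.of_injective g ?_
      rw [injective_iff_map_eq_zero]
      intro c hc
      have h1 : N.mkQ (c.1 : V) = 0 := congrArg Subtype.val hc
      have h2 : (c.1 : V) ∈ N := (Submodule.Quotient.mk_eq_zero N).1 h1
      have h3 : c.1 ∈ (J ⊓ N).comap J.subtype ⊓ C := ⟨⟨c.1.2, h2⟩, c.2⟩
      rw [hC.inf_eq_bot, Submodule.mem_bot] at h3
      exact Subtype.ext h3
    infer_instance
  · intro x hx
    have : (⟨x, hx⟩ : J) ∈ (J ⊓ N).comap J.subtype ⊔ C := by rw [hC.sup_eq_top]; trivial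
    obtain ⟨y, hy, c, hc, h⟩ := Submodule.mem_sup.1 this
    have hx' : x = y.1 + c.1 := congrArg Subtype.val h.symm
    rw [hx', add_comm]
    exact add_mem (Submodule.mem_sup_left ⟨c, hc, rfl⟩) (Submodule.mem_sup_right (hJN hy))

end FiniteCodim

variable {K : Type*} [Field K] {X : Type*} [Fintype X] {A : Type*} [Ring A] [Algebra K A]

/-- Let `A → R` be a surjection onto a free algebra with kernel `J`, and let `Δ` be a finitely
presented left ideal of `A` that contains lifts of the generators. If `J * Δ` absorbs `J` under
multiplication by an element with nonzero image in `R`, then it has finite codimension in `J`. -/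
theorem exists_finite_le_sup_mul {a b : ℕ} (π : A →ₐ[K] MonoidAlgebra K (FreeMonoid X))
    (hπ : Function.Surjective π) (φ : (Fin a → A) →ₗ[A] A) (g : (Fin b → A) →ₗ[A] (Fin a → A))
    (hφg : Function.Exact g φ) (hφ : ∀ v, (π (φ v)).coeff 1 = 0)
    (α : X → Fin a → A) (hα : ∀ x, π (φ (α x)) = gen x) (J Δ : Submodule K A)
    (hJ : ∀ y, y ∈ J ↔ π y = 0) (hΔ : ∀ y, y ∈ Δ ↔ y ∈ LinearMap.range φ)
    (hJΔ : J ≤ Δ) (n : A) (hn : π n ≠ 0) (hnJ : ∀ y ∈ J, n * y ∈ J * Δ) :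
    ∃ B : Submodule K A, FiniteDimensional K B ∧ J ≤ B ⊔ J * Δ := by
  have hsurj : RingHomSurjective (π : A →+* MonoidAlgebra K (FreeMonoid X)) := ⟨hπ⟩
  let Pr : (Fin a → A) →ₛₗ[(π : A →+* MonoidAlgebra K (FreeMonoid X))]
      (Fin a → MonoidAlgebra K (FreeMonoid X)) :=
    { toFun := fun v i => π (v i)
      map_add' := fun v w => funext fun i => map_add π _ _
      map_smul' := fun c v => funext fun i => map_mul π _ _ }
  have hPr : ∀ v i, Pr v i = π (v i) := fun _ _ => rfl
  -- With `hlift` this shows that `J * Δ` is the image under `φ` of the vectors with all coordinates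
  -- in `J`.
  have hmem : ∀ w, Pr w = 0 → φ w ∈ J * Δ := by
    intro w hw
    rw [show w = ∑ i, w i • Pi.single i (1 : A) by
      ext j; simp [Finset.sum_apply, Pi.single_apply], map_sum]
    refine Submodule.sum_mem _ fun i _ => ?_
    rw [map_smul, smul_eq_mul]
    exact Submodule.mul_mem_mul ((hJ _).2 (congrFun hw i)) ((hΔ _).2 ⟨_, rfl⟩)
  have hlift : ∀ y ∈ J * Δ, ∃ w, Pr w = 0 ∧ φ w = y := by
    intro y hy
    induction hy using Submodule.mul_induction_on' with
    | mem_mul_mem j hj δ hδ =>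
      obtain ⟨w, rfl⟩ := (hΔ δ).1 hδ
      refine ⟨j • w, ?_, map_smul φ j w⟩
      rw [LinearMap.map_smulₛₗ]
      change π j • Pr w = 0
      rw [(hJ j).1 hj, zero_smul]
    | add y _ z _ hy hz =>
      obtain ⟨w, hw, rfl⟩ := hy
      obtain ⟨w', hw', rfl⟩ := hz
      exact ⟨w + w', by rw [map_add, hw, hw', add_zero], map_add φ _ _⟩
  -- Modulo the image of `g`, the vectors over the free algebra present `Δ / J * Δ`. The `α x` lift
  -- a basis of the augmentation ideal of the free algebra; dividing them out as well leaves `J / J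
  -- * Δ`.
  let T : Submodule A (Fin a → A) := LinearMap.range g ⊔ Submodule.span A (Set.range α)
  have hT : T.FG := Submodule.FG.sup (Submodule.fg_range g)
    (Submodule.fg_span (Set.finite_range α))
  let S := T.map Pr
  have hS : S.FG := hT.map Pr
  let C : Submodule A A := Submodule.span A (Set.range fun x => φ (α x))
  -- The generators are left independent in the free algebra, so a combination of their lifts that
  -- maps to zero has coefficients in `J`.
  have hCJ : ∀ c ∈ C, π c = 0 → c ∈ J * Δ := by
    intro c hc h0
    obtain ⟨r, rfl⟩ := (Submodule.mem_span_range_iff_exists_fun A).1 hc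
    refine Submodule.sum_mem _ fun x _ => ?_
    refine Submodule.mul_mem_mul ((hJ _).2 ?_) ((hΔ _).2 ⟨_, rfl⟩)
    rw [← rd_sum_mul_gen x fun x => π (r x)]
    rw [map_sum] at h0
    simp only [smul_eq_mul, map_mul, hα] at h0
    rw [h0, map_zero]
  have hnS : ∀ v, π n • v ∈ S := by
    intro v
    obtain ⟨w, rfl⟩ : ∃ w, Pr w = v := by
      choose w hw using fun i => hπ (v i)
      exact ⟨w, funext hw⟩
    choose r hr using fun x => hπ (rd x (π (φ w)))
    -- Subtracting lifts of the coordinates of `π (φ w)` moves `φ w` into `J`, where the hypothesis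
    -- on `n` applies.
    have hsum : φ w - ∑ x, r x * φ (α x) ∈ J := by
      rw [hJ, map_sub, map_sum, sub_eq_zero]
      conv_lhs => rw [eq_add_sum_mul_gen (π (φ w)), hφ, zero_smul, zero_add]
      simp only [map_mul, hr, hα]
    obtain ⟨w', hw', hφw'⟩ := hlift _ (hnJ _ hsum)
    have hker : φ (n • w - n • ∑ x, r x • α x - w') = 0 := by
      rw [map_sub, map_sub, hφw', map_smul, map_smul, map_sum]
      simp only [map_smul, smul_eq_mul, mul_sub]
      abel
    obtain ⟨z, hz⟩ := (hφg _).1 hker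
    have : n • w - w' ∈ T := by
      have e : n • w - w' = g z + n • ∑ x, r x • α x := by rw [hz]; abel
      rw [e]
      refine add_mem (Submodule.mem_sup_left ⟨z, rfl⟩) (Submodule.mem_sup_right ?_)
      exact Submodule.smul_mem _ _ (Submodule.sum_mem _ fun x _ =>
        Submodule.smul_mem _ _ (Submodule.subset_span ⟨x, rfl⟩))
    refine ⟨_, this, ?_⟩
    rw [map_sub, hw', sub_zero, LinearMap.map_smulₛₗ]
    rfl
  obtain ⟨D, hD⟩ := exists_sub_mem_vecDegLT S hS hn hnS
  let Prl : (Fin a → A) →ₗ[K] (Fin a → MonoidAlgebra K (FreeMonoid X)) :=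
    LinearMap.pi fun i => π.toLinearMap ∘ₗ LinearMap.proj i
  have hPrl : ∀ w, Prl w = Pr w := fun _ => rfl
  have hPrsurj : Function.Surjective Prl := fun v => by
    choose w hw using fun i => hπ (v i)
    exact ⟨w, funext hw⟩
  obtain ⟨σ, hσ⟩ := LinearMap.exists_rightInverse_of_surjective Prl (LinearMap.range_eq_top.2 hPrsurj)
  have hσ' : ∀ v, Pr (σ v) = v := fun v => LinearMap.congr_fun hσ v
  have := finite_vecDegLT (K := K) (X := X) (a := Fin a) D
  let B := (vecDegLT K X (Fin a) D).map (φ.restrictScalars K ∘ₗ σ)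
  have hB : FiniteDimensional K B := inferInstance
  -- Modulo `S` every vector has bounded degree, which puts `J` into `B + C + J * Δ`. The summand
  -- `C` is then removed by `hCJ`.
  refine exists_finite_le_sup (B := B) (N := C.restrictScalars K ⊔ J * Δ) ?_ ?_
  · intro y hy
    obtain ⟨w, rfl⟩ := (hΔ y).1 (hJΔ hy)
    obtain ⟨_, ⟨t, ht, rfl⟩, hf⟩ := hD (Pr w)
    have hz : φ (w - t - σ (Pr w - Pr t)) ∈ J * Δ := by
      apply hmem
      rw [map_sub, map_sub, hσ', sub_self]
    have ht' : φ t ∈ C := by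
      have : T ≤ C.comap φ := by
        refine sup_le ?_ ?_
        · rintro _ ⟨z, rfl⟩
          change φ (g z) ∈ C
          rw [(hφg _).2 ⟨z, rfl⟩]
          exact zero_mem _
        · rw [Submodule.span_le]
          rintro _ ⟨x, rfl⟩
          exact Submodule.subset_span ⟨x, rfl⟩
      exact this ht
    have e : φ w = φ (σ (Pr w - Pr t)) + (φ t + φ (w - t - σ (Pr w - Pr t))) := by
      rw [← map_add, ← map_add]; congr 1; abel
    rw [e]
    exact add_mem (Submodule.mem_sup_left ⟨_, hf, rfl⟩)
      (Submodule.mem_sup_right (add_mem (Submodule.mem_sup_left ht') (Submodule.mem_sup_right hz)))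
  · rintro y ⟨hy, hyN⟩
    obtain ⟨c, hc, z, hz, rfl⟩ := Submodule.mem_sup.1 hyN
    refine add_mem (hCJ c hc ?_) hz
    have h1 : π (c + z) = 0 := (hJ _).1 hy
    have h2 : π z = 0 := by
      have : J * Δ ≤ J := by
        rw [Submodule.mul_le]
        intro j hj δ _
        rw [hJ, map_mul, (hJ j).1 hj, zero_mul]
      exact (hJ z).1 (this hz)
    rwa [map_add, h2, add_zero] at h1

end FreeWords

/-! ### The case of two factors. -/

namespace FreeWords

attribute [local instance 100] LieRing.ofAssociativeRing

open MonoidAlgebra UEAMap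

section Quotient

variable {K : Type*} [Field K] {X : Type*} [Fintype X] {Q : Type*} [LieRing Q] [LieAlgebra K Q]

/-- Let `J` be the kernel of a homomorphism from a free algebra, with augmentation ideal `Δ`, onto
the enveloping algebra of a nonzero Lie algebra. If `J * Δ` has finite codimension in `J`, then
`J` vanishes. -/
theorem eq_zero_of_le_sup_mul (ψ : MonoidAlgebra K (FreeMonoid X) →ₐ[K]
      UniversalEnvelopingAlgebra K Q) (hψ : Function.Surjective ψ) {q : Q} (hq : q ≠ 0)
    (hε : ∀ r, ψ r = 0 → r.coeff 1 = 0) (J Δ B : Submodule K (MonoidAlgebra K (FreeMonoid X)))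
    (hJ : ∀ r, r ∈ J ↔ ψ r = 0) (hΔ : ∀ r ∈ Δ, r.coeff 1 = 0) [FiniteDimensional K B]
    (hB : J ≤ B ⊔ J * Δ) {r : MonoidAlgebra K (FreeMonoid X)} (hr : r ∈ J) : r = 0 := by
  have hdec : ∀ r : MonoidAlgebra K (FreeMonoid X), r.coeff 1 = 0 → r = ∑ x, rd x r * gen x :=
    fun r h => by
      conv_lhs => rw [eq_add_sum_mul_gen r, h, zero_smul, zero_add]
  have hrd_mul : ∀ (s r : MonoidAlgebra K (FreeMonoid X)) (x : X), r.coeff 1 = 0 →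
      rd x (s * r) = s * rd x r := by
    intro s r x h
    conv_lhs => rw [hdec r h]
    rw [Finset.mul_sum]
    simp only [← mul_assoc]
    rw [rd_sum_mul_gen x fun y => s * rd y r]
  -- On elements without constant term `rd x` is left linear, so the maps `ψ ∘ rd x` are defined on
  -- `J / J * Δ` with values in `U(Q)`.
  have hJΔ : ∀ r ∈ J * Δ, ∀ x, ψ (rd x r) = 0 := by
    intro r hr x
    induction hr using Submodule.mul_induction_on' with
    | mem_mul_mem j hj δ hδ => rw [hrd_mul _ _ _ (hΔ δ hδ), map_mul, (hJ j).1 hj, zero_mul]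
    | add r _ s _ hr hs => rw [map_add, map_add, hr, hs, add_zero]
  obtain ⟨y, hy⟩ := hψ (UniversalEnvelopingAlgebra.ι K q)
  -- The image of `J` under `ψ ∘ rd x` is finite-dimensional and stable under multiplication by `q`,
  -- hence zero by PBW.
  have hrdJ : ∀ r ∈ J, ∀ x, rd x r ∈ J := by
    intro r hr x
    let θ : MonoidAlgebra K (FreeMonoid X) →ₗ[K] UniversalEnvelopingAlgebra K Q :=
      ψ.toLinearMap ∘ₗ rd x
    have hle : J.map θ ≤ B.map θ := by
      rintro _ ⟨j, hj, rfl⟩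
      obtain ⟨b, hb, z, hz, rfl⟩ := Submodule.mem_sup.1 (hB hj)
      refine ⟨b, hb, ?_⟩
      have : θ z = 0 := hJΔ z hz x
      rw [map_add, this, add_zero]
    have : FiniteDimensional K (J.map θ) := Submodule.finiteDimensional_of_le hle
    have hbot := PBW.eq_bot_of_ι_mul_mem hq (J.map θ) (by
      rintro _ ⟨j, hj, rfl⟩
      refine ⟨y * j, (hJ _).2 (by rw [map_mul, (hJ j).1 hj, mul_zero]), ?_⟩
      change ψ (rd x (y * j)) = _ * ψ (rd x j)
      rw [hrd_mul _ _ _ (hε j ((hJ j).1 hj)), map_mul, hy])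
    rw [hJ]
    have : θ r ∈ J.map θ := ⟨r, hr, rfl⟩
    rwa [hbot, Submodule.mem_bot] at this
  -- Elements of `J` have no constant term and `J` is closed under removing final letters, so
  -- descent on the degree kills `r`.
  obtain ⟨m, hm⟩ := exists_mem_degLT r
  induction m generalizing r with
  | zero => ext w; exact hm w (Nat.zero_le _)
  | succ m ih =>
    rw [hdec r (hε r ((hJ r).1 hr))]
    refine Finset.sum_eq_zero fun x _ => ?_
    rw [ih (hrdJ r hr x), zero_mul]
    intro w hw
    rw [coeff_rd]
    apply hm
    rw [FreeMonoid.length_mul, FreeMonoid.length_of]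
    omega

end Quotient

section Pair

variable {K : Type v} [Field K] {L : Type u} {F₁ F₂ : Type*} [LieRing L] [LieAlgebra K L]
  [LieRing F₁] [LieAlgebra K F₁] [LieRing F₂] [LieAlgebra K F₂]

/-- If `L` is of type `FP_2` and `p : L → F` is a surjection onto a finitely generated free Lie
algebra whose kernel is centralized by an element outside it, then the first homology of the
kernel of `p` is finite-dimensional. -/
theorem exists_finite_ker_le (hFP : LieAlgebra.IsFP K L 2) {X : Type*} [Fintype X]
    (e : F₁ ≃ₗ⁅K⁆ FreeLieAlgebra K X) (p : L →ₗ⁅K⁆ F₁) (hp : Function.Surjective p)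
    (n : L) (hn : p n ≠ 0) (hcomm : ∀ m, p m = 0 → ⁅n, m⁆ = 0) :
    ∃ B : Submodule K (UniversalEnvelopingAlgebra K L), FiniteDimensional K B ∧
      LinearMap.ker (uMap p).toLinearMap ≤
        B ⊔ LinearMap.ker (uMap p).toLinearMap *
          LinearMap.ker (LieAlgebra.augmentation K L).toLinearMap := by
  obtain ⟨C, hC⟩ := hFP
  let one : LieAlgebra.TrivialUModule K L := (1 : K)
  let τ : UniversalEnvelopingAlgebra K L →ₗ[UniversalEnvelopingAlgebra K L]
      LieAlgebra.TrivialUModule K L := LinearMap.toSpanSingleton _ _ one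
  have hτ : ∀ a, τ a = (LieAlgebra.augmentation K L a : K) := fun a => by
    change LieAlgebra.augmentation K L a * (1 : K) = _
    rw [mul_one]
  have hτsurj : Function.Surjective τ := fun c =>
    ⟨algebraMap K _ (show K from c), by rw [hτ, AlgHom.commutes]; rfl⟩
  -- The augmentation ideal is the kernel of `U(L) → K`, so `FP_2` makes it finitely presented.
  have hfp := C.finitePresentation_ker hC τ hτsurj
  have hτker : ∀ a, a ∈ LinearMap.ker τ ↔ LieAlgebra.augmentation K L a = 0 := fun a => by
    rw [LinearMap.mem_ker, hτ]; rfl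
  obtain ⟨a, b, f, g, hf, hgf⟩ := Module.FinitePresentation.exists_fin'
    (UniversalEnvelopingAlgebra K L) (LinearMap.ker τ)
  let φ : (Fin a → UniversalEnvelopingAlgebra K L) →ₗ[UniversalEnvelopingAlgebra K L]
      UniversalEnvelopingAlgebra K L := (LinearMap.ker τ).subtype ∘ₗ f
  have hφ : ∀ v, LieAlgebra.augmentation K L (φ v) = 0 := fun v => (hτker _).1 (f v).2
  let π := ((freeEquiv e : UniversalEnvelopingAlgebra K F₁ →ₐ[K]
    MonoidAlgebra K (FreeMonoid X))).comp (uMap p)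
  have hπ : ∀ y, π y = freeEquiv e (uMap p y) := fun _ => rfl
  choose l hl using fun x => hp (e.symm (FreeLieAlgebra.of K x))
  choose α hα using fun x => hf ⟨UniversalEnvelopingAlgebra.ι K (l x),
    (hτker _).2 (augmentation_ι (l x))⟩
  have hα' : ∀ x, φ (α x) = UniversalEnvelopingAlgebra.ι K (l x) := fun x =>
    congrArg Subtype.val (hα x)
  have hker : ∀ y, π y = 0 ↔ uMap p y = 0 := fun y => by
    rw [hπ, EmbeddingLike.map_eq_zero_iff]
  refine exists_finite_le_sup_mul π ((freeEquiv e).surjective.comp (uMap_surjective hp)) φ g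
    (fun v => ?_) (fun v => ?_) α (fun x => ?_) _ _ (fun y => (hker y).symm) (fun y => ?_)
    (fun y hy => ?_) (UniversalEnvelopingAlgebra.ι K n) ?_ (fun y hy => ?_)
  · rw [← hgf v]
    change (f v : UniversalEnvelopingAlgebra K L) = 0 ↔ _
    exact ZeroMemClass.coe_eq_zero
  · rw [hπ, ← augmentation_eq_coeff e, augmentation_uMap, hφ]
  · rw [hα', hπ, uMap_ι, hl, freeEquiv_ι]
  · constructor
    · intro hy
      obtain ⟨v, hv⟩ := hf ⟨y, (hτker y).2 hy⟩
      exact ⟨v, congrArg Subtype.val hv⟩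
    · rintro ⟨v, rfl⟩
      exact hφ v
  · change LieAlgebra.augmentation K L y = 0
    have hy' : uMap p y = 0 := hy
    rw [← augmentation_uMap p, hy', map_zero]
  · rw [Ne, hker, uMap_ι]
    intro h
    exact hn (PBW.ι_injective K F₁ (h.trans (map_zero _).symm))
  -- `J` is spanned by products `m c` with `m` in the kernel of `p`. As `n` commutes with `m`, one
  -- has `n m c = m (n c)`, and `n c` lies in the augmentation ideal.
  · have hy' := mem_kerSpan_of_uMap_eq_zero hp (u := y) hy
    clear hy
    induction hy' using Submodule.span_induction with
    | mem y hy =>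
      obtain ⟨m, c, hm, rfl⟩ := hy
      have h1 := hcomm m hm
      have h2 : UniversalEnvelopingAlgebra.ι K n * UniversalEnvelopingAlgebra.ι K m =
          UniversalEnvelopingAlgebra.ι K m * UniversalEnvelopingAlgebra.ι K n := by
        rw [← sub_eq_zero, ← LieRing.of_associative_ring_bracket, ← LieHom.map_lie, h1, map_zero]
      rw [← mul_assoc, h2, mul_assoc]
      refine Submodule.mul_mem_mul ?_ ?_
      · change uMap p (UniversalEnvelopingAlgebra.ι K m) = 0
        rw [uMap_ι, hm, map_zero]
      · change LieAlgebra.augmentation K L (UniversalEnvelopingAlgebra.ι K n * c) = 0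
        rw [map_mul, augmentation_ι, zero_mul]
    | zero => rw [mul_zero]; exact zero_mem _
    | add y z _ _ h1 h2 => rw [mul_add]; exact add_mem h1 h2
    | smul c y _ h => rw [mul_smul_comm]; exact Submodule.smul_mem _ c h

/-- If `L` is of type `FP_2` and maps onto two finitely generated free Lie algebras such that
the kernel of the first map is centralized by an element outside it and is not contained in the
kernel of the second, then the kernel of the first map surjects onto the second Lie algebra. -/
theorem exists_ker_eq (hFP : LieAlgebra.IsFP K L 2) {X₁ X₂ : Type*} [Fintype X₁] [Fintype X₂]
    (e₁ : F₁ ≃ₗ⁅K⁆ FreeLieAlgebra K X₁) (e₂ : F₂ ≃ₗ⁅K⁆ FreeLieAlgebra K X₂)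
    (p₁ : L →ₗ⁅K⁆ F₁) (hp₁ : Function.Surjective p₁)
    (p₂ : L →ₗ⁅K⁆ F₂) (hp₂ : Function.Surjective p₂)
    (n : L) (hn : p₁ n ≠ 0) (hcomm : ∀ m, p₁ m = 0 → ⁅n, m⁆ = 0)
    (n' : L) (hn' : p₁ n' = 0) (hn₂ : p₂ n' ≠ 0) (y : F₂) : ∃ m, p₁ m = 0 ∧ p₂ m = y := by
  obtain ⟨B, hB, hle⟩ := exists_finite_ker_le hFP e₁ p₁ hp₁ n hn hcomm
  let I : LieIdeal K F₂ :=
    { (LinearMap.ker p₁.toLinearMap).map p₂.toLinearMap with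
      lie_mem := by
        rintro x _ ⟨m, hm, rfl⟩
        obtain ⟨z, rfl⟩ := hp₂ x
        have hm' : p₁ m = 0 := hm
        exact ⟨⁅z, m⁆, by
          change p₁ ⁅z, m⁆ = 0
          rw [LieHom.map_lie, hm', lie_zero], LieHom.map_lie p₂ z m⟩ }
  have hI : ∀ z, z ∈ I ↔ ∃ m, p₁ m = 0 ∧ p₂ m = z := fun z => Iff.rfl
  by_contra hy
  rw [← hI] at hy
  let mk : F₂ →ₗ⁅K⁆ F₂ ⧸ I :=
    { (LieSubmodule.Quotient.mk' I : F₂ →ₗ[K] F₂ ⧸ I) with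
      map_lie' := fun {x z} => LieSubmodule.Quotient.mk_bracket I x z }
  have hmk : ∀ z, mk z = 0 ↔ z ∈ I := fun z => LieSubmodule.Quotient.mk_eq_zero I
  have hmks : Function.Surjective mk := LieSubmodule.Quotient.surjective_mk' I
  let ψ := (uMap mk).comp ((freeEquiv e₂).symm : MonoidAlgebra K (FreeMonoid X₂) →ₐ[K]
    UniversalEnvelopingAlgebra K F₂)
  have hψ : ∀ u, ψ (freeEquiv e₂ u) = uMap mk u := fun u => by
    change uMap mk ((freeEquiv e₂).symm (freeEquiv e₂ u)) = _
    rw [AlgEquiv.symm_apply_apply]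
  let π := ((freeEquiv e₂ : UniversalEnvelopingAlgebra K F₂ →ₐ[K]
    MonoidAlgebra K (FreeMonoid X₂))).comp (uMap p₂)
  have hπ : ∀ u, π u = freeEquiv e₂ (uMap p₂ u) := fun _ => rfl
  -- The kernels of both maps of enveloping algebras are right ideals generated by Lie kernels, and
  -- `p₂` carries the kernel of `p₁` onto `I`.
  have hJ : ∀ r, r ∈ (LinearMap.ker (uMap p₁).toLinearMap).map π.toLinearMap ↔ ψ r = 0 := by
    intro r
    constructor
    · rintro ⟨u, hu, rfl⟩
      have hu' := mem_kerSpan_of_uMap_eq_zero hp₁ (u := u) hu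
      change ψ (freeEquiv e₂ (uMap p₂ u)) = 0
      rw [hψ]
      clear hu
      induction hu' using Submodule.span_induction with
      | mem u hu =>
        obtain ⟨m, c, hm, rfl⟩ := hu
        rw [map_mul, map_mul, uMap_ι, uMap_ι, (hmk _).2 ((hI _).2 ⟨m, hm, rfl⟩), map_zero, zero_mul]
      | zero => rw [map_zero, map_zero]
      | add u v _ _ h1 h2 => rw [map_add, map_add, h1, h2, add_zero]
      | smul c u _ h => rw [map_smul, map_smul, h, smul_zero]
    · intro hr
      obtain ⟨s, rfl⟩ := (freeEquiv e₂).surjective r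
      rw [hψ] at hr
      have hs := mem_kerSpan_of_uMap_eq_zero hmks hr
      clear hr
      induction hs using Submodule.span_induction with
      | mem u hu =>
        obtain ⟨i, c, hi, rfl⟩ := hu
        obtain ⟨m, hm, rfl⟩ := (hI i).1 ((hmk i).1 hi)
        obtain ⟨c, rfl⟩ := uMap_surjective hp₂ c
        refine ⟨UniversalEnvelopingAlgebra.ι K m * c, ?_, ?_⟩
        · change uMap p₁ _ = 0
          rw [map_mul, uMap_ι, hm, map_zero, zero_mul]
        · change freeEquiv e₂ (uMap p₂ _) = _
          rw [map_mul (uMap p₂), uMap_ι]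
      | zero => rw [map_zero]; exact zero_mem _
      | add u v _ _ h1 h2 => rw [map_add]; exact add_mem h1 h2
      | smul c u _ h => rw [map_smul]; exact Submodule.smul_mem _ _ h
  -- Since `y ∉ I`, its class is a nonzero element of `F₂ / I`. The ideal must then vanish, although
  -- it contains the image of `p₂ n'`.
  have hzero := eq_zero_of_le_sup_mul ψ ((uMap_surjective hmks).comp (freeEquiv e₂).symm.surjective)
    (q := mk y) (fun h => hy ((hmk y).1 h)) (fun r hr => by
      obtain ⟨s, rfl⟩ := (freeEquiv e₂).surjective r
      rw [hψ] at hr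
      rw [← augmentation_eq_coeff e₂, ← augmentation_uMap mk, hr, map_zero])
    _ ((LinearMap.ker (LieAlgebra.augmentation K L).toLinearMap).map π.toLinearMap)
    (B.map π.toLinearMap) hJ (by
      rintro _ ⟨u, hu, rfl⟩
      change (freeEquiv e₂ (uMap p₂ u)).coeff 1 = 0
      rw [← augmentation_eq_coeff e₂, augmentation_uMap]
      exact hu) (by
      rw [← Submodule.map_mul, ← Submodule.map_sup]
      exact Submodule.map_mono hle) (r := freeEquiv e₂ (UniversalEnvelopingAlgebra.ι K (p₂ n'))) (by
      refine ⟨UniversalEnvelopingAlgebra.ι K n', ?_, ?_⟩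
      · change uMap p₁ (UniversalEnvelopingAlgebra.ι K n') = 0
        rw [uMap_ι, hn', map_zero]
      · change freeEquiv e₂ (uMap p₂ _) = _
        rw [uMap_ι])
  rw [EmbeddingLike.map_eq_zero_iff] at hzero
  exact hn₂ (PBW.ι_injective K F₂ (hzero.trans (map_zero _).symm))

end Pair

end FreeWords

/-! ### Cup products of twisted derivations, evaluated on Koszul cycles. -/

namespace KoszulLift

attribute [local instance 100] LieRing.ofAssociativeRing

open Polynomial

section Sign

/-- The sign of the position of `i` in the finite set `I`. -/
def pos (i : ℕ) (I : Finset ℕ) : ℤ := (-1) ^ (I.filter (· < i)).card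

theorem pos_sq (i : ℕ) (I : Finset ℕ) : pos i I * pos i I = 1 := by
  rw [pos, ← mul_pow, neg_one_mul, neg_neg, one_pow]

theorem pos_mul_pos_of_lt {i k : ℕ} {I : Finset ℕ} (hi : i ∈ I) (h : i < k) :
    pos i I * pos k (I.erase i) = -(pos k I * pos i (I.erase k)) := by
  have h1 : (I.erase k).filter (· < i) = I.filter (· < i) := by
    rw [Finset.filter_erase, Finset.erase_eq_of_notMem]
    simp only [Finset.mem_filter, not_and, not_lt]
    exact fun _ => h.le
  have h2 : ((I.erase i).filter (· < k)).card + 1 = (I.filter (· < k)).card := by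
    rw [Finset.filter_erase]
    exact Finset.card_erase_add_one (Finset.mem_filter.2 ⟨hi, h⟩)
  rw [pos, pos, pos, pos, h1, ← h2, pow_succ]
  ring

theorem pos_mul_pos {i k : ℕ} {I : Finset ℕ} (hi : i ∈ I) (hk : k ∈ I) (h : i ≠ k) :
    pos i I * pos k (I.erase i) = -(pos k I * pos i (I.erase k)) := by
  rcases lt_or_gt_of_ne h with h | h
  · exact pos_mul_pos_of_lt hi h
  · rw [pos_mul_pos_of_lt hk h, neg_neg]

/-- The Koszul differential squares to zero. -/
theorem koszul_sq {U M : Type*} [Ring U] [AddCommGroup M] [Module U M] (a : ℕ → U)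
    (ha : ∀ i k, a i * a k = a k * a i) (q : Finset ℕ → M) (I : Finset ℕ) :
    ∑ i ∈ I, pos i I • a i • ∑ k ∈ I.erase i,
      pos k (I.erase i) • a k • q ((I.erase i).erase k) = 0 := by
  simp only [Finset.smul_sum]
  rw [Finset.sum_sigma']
  refine Finset.sum_involution (fun x _ => ⟨x.2, x.1⟩) ?_ ?_ ?_ ?_
  · rintro ⟨i, k⟩ h
    rw [Finset.mem_sigma, Finset.mem_erase] at h
    obtain ⟨hi, hki, hk⟩ := h
    simp only at hi hki hk ⊢
    rw [Finset.erase_right_comm (a := k), smul_comm (a i) (pos k _), smul_comm (a k) (pos i _),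
      smul_smul, smul_smul, smul_smul, smul_smul, pos_mul_pos hi hk (Ne.symm hki), ha i k, neg_smul,
      neg_add_cancel]
  · rintro ⟨i, k⟩ h _ heq
    rw [Finset.mem_sigma, Finset.mem_erase] at h
    exact h.2.1 (congrArg Sigma.fst heq)
  · rintro ⟨i, k⟩ h
    rw [Finset.mem_sigma, Finset.mem_erase] at h ⊢
    exact ⟨h.2.2, Ne.symm h.2.1, h.1⟩
  · rintro ⟨i, k⟩ _
    rfl

end Sign

section RepMod

variable {K : Type*} [Field K] {L : Type*} [LieRing L] [LieAlgebra K L]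

/-- A representation of a Lie algebra as a module over the enveloping algebra. -/
@[nolint unusedArguments]
def RepMod {V : Type*} [AddCommGroup V] [Module K V] (_ : L →ₗ⁅K⁆ Module.End K V) : Type _ := V

variable {V : Type*} [AddCommGroup V] [Module K V] (ρ : L →ₗ⁅K⁆ Module.End K V)

instance : AddCommGroup (RepMod ρ) := inferInstanceAs (AddCommGroup V)

instance : Module K (RepMod ρ) := inferInstanceAs (Module K V)

noncomputable instance : Module (UniversalEnvelopingAlgebra K L) (RepMod ρ) :=
  Module.compHom V (UniversalEnvelopingAlgebra.lift K ρ).toRingHom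

theorem ι_smul_repMod (x : L) (v : RepMod ρ) :
    UniversalEnvelopingAlgebra.ι K x • v = (ρ x (show V from v) : V) := by
  change (UniversalEnvelopingAlgebra.lift K ρ (UniversalEnvelopingAlgebra.ι K x)) (show V from v) = _
  rw [UniversalEnvelopingAlgebra.lift_ι_apply]

instance : IsScalarTower K (UniversalEnvelopingAlgebra K L) (RepMod ρ) where
  smul_assoc c u v := by
    change (UniversalEnvelopingAlgebra.lift K ρ (c • u)) (show V from v) =
      c • (UniversalEnvelopingAlgebra.lift K ρ u) (show V from v)
    rw [map_smul]
    rfl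

theorem algebraMap_smul_repMod (c : K) (v : RepMod ρ) :
    algebraMap K (UniversalEnvelopingAlgebra K L) c • v = (c • (show V from v) : V) :=
  algebraMap_smul _ c v

/-- An additive map that commutes with scalars and with the action of `L` is linear over the
enveloping algebra. -/
noncomputable def linearOfCommutes {M N : Type*} [AddCommGroup M]
    [Module (UniversalEnvelopingAlgebra K L) M]
    [AddCommGroup N] [Module (UniversalEnvelopingAlgebra K L) N] (f : M →+ N)
    (h₁ : ∀ (c : K) m, f (algebraMap K (UniversalEnvelopingAlgebra K L) c • m) =
      algebraMap K (UniversalEnvelopingAlgebra K L) c • f m)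
    (h₂ : ∀ (x : L) m, f (UniversalEnvelopingAlgebra.ι K x • m) =
      UniversalEnvelopingAlgebra.ι K x • f m) : M →ₗ[UniversalEnvelopingAlgebra K L] N where
  __ := f
  map_smul' u m := by
    change f (u • m) = u • f m
    have hu : u ∈ Algebra.adjoin K (Set.range (UniversalEnvelopingAlgebra.ι K : L → _)) := by
      rw [PBW.adjoin_range_ι]; trivial
    induction hu using Algebra.adjoin_induction generalizing m with
    | mem _ hx => obtain ⟨x, rfl⟩ := hx; exact h₂ x m
    | algebraMap c => exact h₁ c m
    | add _ _ _ _ h1 h2 => rw [add_smul, map_add, h1, h2, add_smul]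
    | mul _ _ _ _ h1 h2 => rw [mul_smul, h1, h2, mul_smul]

end RepMod

section Characters

variable {K : Type*} [Field K] {L : Type*} [LieRing L] [LieAlgebra K L]

/-- The action of `L` on `K[t]` through multiples of `t`. -/
noncomputable def charRep (μ : L →ₗ[K] K) (hμ : ∀ x y : L, μ ⁅x, y⁆ = 0) : L →ₗ⁅K⁆ Module.End K K[X] where
  toFun x := LinearMap.mulLeft K (C (μ x) * X)
  map_add' x y := by
    refine LinearMap.ext fun f => ?_
    simp [add_mul, mul_assoc]
  map_smul' c x := by
    refine LinearMap.ext fun f => ?_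
    simp [smul_eq_C_mul, mul_assoc]
  map_lie' {x y} := by
    rw [LieRing.of_associative_ring_bracket]
    refine LinearMap.ext fun f => ?_
    simp only [hμ, LinearMap.mulLeft_apply, LinearMap.sub_apply, Module.End.mul_apply, map_zero]
    ring

/-- An upper triangular endomorphism of `K[t]²`. -/
noncomputable def triangular (α β : K) (f : K[X]) : Module.End K (K[X] × K[X]) where
  toFun p := (C α * X * p.1 + f * p.2, C β * X * p.2)
  map_add' p q := by
    ext1 <;> simp only [Prod.fst_add, Prod.snd_add] <;> ring
  map_smul' a p := by
    ext1 <;> simp only [Prod.smul_fst, Prod.smul_snd, smul_eq_C_mul, RingHom.id_apply] <;> ring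

theorem triangular_apply (α β : K) (f : K[X]) (p : K[X] × K[X]) :
    triangular α β f p = (C α * X * p.1 + f * p.2, C β * X * p.2) := rfl

/-- The extension of two actions of `L` on `K[t]` that is defined by a twisted derivation. -/
noncomputable def pairRep (μ μ' : L →ₗ[K] K) (hμ : ∀ x y : L, μ ⁅x, y⁆ = 0)
    (hμ' : ∀ x y : L, μ' ⁅x, y⁆ = 0) (c : L →ₗ[K] K[X])
    (hc : ∀ x y : L, c ⁅x, y⁆ = C (μ' x - μ x) * X * c y - C (μ' y - μ y) * X * c x) :
    L →ₗ⁅K⁆ Module.End K (K[X] × K[X]) where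
  toFun x := triangular (μ' x) (μ x) (c x)
  map_add' x y := by
    refine LinearMap.ext fun p => ?_
    rw [LinearMap.add_apply]
    simp only [triangular_apply, map_add, Prod.mk_add_mk]
    ext1 <;> dsimp only <;> ring
  map_smul' a x := by
    refine LinearMap.ext fun p => ?_
    rw [LinearMap.smul_apply]
    simp only [triangular_apply, map_smul, smul_eq_mul, map_mul, Prod.smul_mk, smul_eq_C_mul,
      RingHom.id_apply]
    ext1 <;> dsimp only <;> ring
  map_lie' {x y} := by
    rw [LieRing.of_associative_ring_bracket]
    refine LinearMap.ext fun p => ?_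
    rw [LinearMap.sub_apply, Module.End.mul_apply, Module.End.mul_apply]
    simp only [triangular_apply, hμ, hμ', hc, map_zero, map_sub, Prod.mk_sub_mk]
    ext1 <;> dsimp only <;> ring

variable (μ μ' : L →ₗ[K] K) (hμ : ∀ x y : L, μ ⁅x, y⁆ = 0)
    (hμ' : ∀ x y : L, μ' ⁅x, y⁆ = 0) (c : L →ₗ[K] K[X])
    (hc : ∀ x y : L, c ⁅x, y⁆ = C (μ' x - μ x) * X * c y - C (μ' y - μ y) * X * c x)

/-- The projection of the extension to its quotient. -/
noncomputable def pairSnd : RepMod (pairRep μ μ' hμ hμ' c hc) →ₗ[UniversalEnvelopingAlgebra K L]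
    RepMod (charRep μ hμ) :=
  linearOfCommutes (AddMonoidHom.snd K[X] K[X])
    (fun a m => by rw [algebraMap_smul_repMod, algebraMap_smul_repMod]; rfl)
    (fun x m => by rw [ι_smul_repMod, ι_smul_repMod]; rfl)

/-- The inclusion into the extension. -/
noncomputable def pairInl : RepMod (charRep μ' hμ') →ₗ[UniversalEnvelopingAlgebra K L]
    RepMod (pairRep μ μ' hμ hμ' c hc) :=
  linearOfCommutes (AddMonoidHom.inl K[X] K[X])
    (fun a m => by
      rw [algebraMap_smul_repMod, algebraMap_smul_repMod]
      exact Prod.ext rfl (smul_zero a).symm)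
    (fun x m => by
      rw [ι_smul_repMod, ι_smul_repMod]
      refine Prod.ext ?_ (mul_zero (C (μ x) * X)).symm
      exact (add_eq_left.2 (mul_zero (c x))).symm)

/-- The inclusion of the constants. -/
noncomputable def constHom (h0 : μ = 0) : LieAlgebra.TrivialUModule K L
    →ₗ[UniversalEnvelopingAlgebra K L] RepMod (charRep μ hμ) :=
  linearOfCommutes (C : K →+* K[X]).toAddMonoidHom
    (fun a m => by
      rw [LieAlgebra.algebraMap_smul_trivialUModule, algebraMap_smul_repMod]
      exact (smul_C a (show K from m)).symm)
    (fun x m => by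
      rw [LieAlgebra.ι_smul_trivialUModule, ι_smul_repMod]
      have h : charRep μ hμ x = 0 := by
        refine LinearMap.ext fun f => ?_
        change C (μ x) * X * f = 0
        rw [h0, LinearMap.zero_apply, map_zero, zero_mul, zero_mul]
      rw [h]
      exact map_zero C)

end Characters

section Lift

variable {K : Type v} [Field K] {L : Type u} [LieRing L] [LieAlgebra K L]
  (R : ModuleProjRes (UniversalEnvelopingAlgebra K L) (LieAlgebra.TrivialUModule K L))
  (μ : ℕ → L →ₗ[K] K) (hμ : ∀ j, ∀ x y : L, μ j ⁅x, y⁆ = 0) (c : ℕ → L →ₗ[K] K[X])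

/-- A commuting family that is killed by all characters, and by all derivations but the one with
the same index. -/
structure IsAdmissible (n : ℕ → L) : Prop where
  comm : ∀ i k, ⁅n i, n k⁆ = 0
  char : ∀ i k, μ k (n i) = 0
  der : ∀ i k, i ≠ k → c k (n i) = 0

/-- A family of Koszul chains over the `j`-th module of a resolution. -/
def IsKoszul (n : ℕ → L) (j : ℕ) (q : Finset ℕ → R.P j) : Prop :=
  ∀ I : Finset ℕ, I.card = j + 1 →
    ∑ i ∈ I, pos i I • UniversalEnvelopingAlgebra.ι K (n i) • q (I.erase i) ∈
      LinearMap.range (R.d j)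

/-- The cocycle `g` represents the cup product of the first `j` twisted derivations, built by
splicing the extensions `pairRep`. The chains `q` are one level of a comparison map from the Koszul
complex of the commuting `n i` to the resolution. The value is the pairing of the two. -/
theorem exists_lift
    (hc : ∀ j, ∀ x y : L, c j ⁅x, y⁆ =
      C (μ (j + 1) x - μ j x) * X * c j y - C (μ (j + 1) y - μ j y) * X * c j x)
    (h0 : μ 0 = 0) (j : ℕ) :
    ∃ g : R.P j →ₗ[UniversalEnvelopingAlgebra K L] RepMod (charRep (μ j) (hμ j)),
      (∀ y, g (R.d j y) = 0) ∧ ∀ n, IsAdmissible μ c n →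
        ∃ q, IsKoszul R n j q ∧ ∃ ε : K, ε ≠ 0 ∧
          g (q (Finset.range j)) = (C ε * ∏ i ∈ Finset.range j, c i (n i) : K[X]) := by
  induction j with
  | zero =>
    refine ⟨constHom (μ 0) (hμ 0) h0 ∘ₗ R.ε, fun y => ?_, fun n _ => ?_⟩
    · rw [LinearMap.comp_apply, (R.exact_zero _).2 ⟨y, rfl⟩, map_zero]
    · obtain ⟨p, hp⟩ := R.ε_surjective (1 : K)
      refine ⟨fun _ => p, fun I hI => ?_, 1, one_ne_zero, ?_⟩
      · obtain ⟨i, rfl⟩ := Finset.card_eq_one.1 hI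
        rw [Finset.sum_singleton]
        refine (R.exact_zero _).1 ?_
        rw [map_zsmul, map_smul, LieAlgebra.ι_smul_trivialUModule, smul_zero]
      · rw [LinearMap.comp_apply, hp]
        exact (mul_one (C (1 : K) : K[X])).symm
  | succ j ih =>
    obtain ⟨g, hg, hgn⟩ := ih
    have := R.projective j
    let snd := pairSnd (μ j) (μ (j + 1)) (hμ j) (hμ (j + 1)) (c j) (hc j)
    let inl := pairInl (μ j) (μ (j + 1)) (hμ j) (hμ (j + 1)) (c j) (hc j)
    have hsnd : Function.Surjective snd := fun b => ⟨((0, b) : K[X] × K[X]), rfl⟩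
    obtain ⟨G, hG⟩ := Module.projective_lifting_property snd g hsnd
    have hG' : ∀ p, snd (G p) = g p := fun p => LinearMap.congr_fun hG p
    -- `g` kills boundaries, so `G ∘ d` lands in the submodule of the extension. This is the next
    -- cocycle.
    have hinl : ∀ y, ∃ a, inl a = G (R.d j y) := fun y => by
      have h : snd (G (R.d j y)) = 0 := by rw [hG', hg]
      exact ⟨(show K[X] × K[X] from G (R.d j y)).1, Prod.ext rfl h.symm⟩
    have hinj : Function.Injective inl := fun a b h =>
      congrArg (fun z : K[X] × K[X] => z.1) h
    choose f hf using hinl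
    let g' : R.P (j + 1) →ₗ[UniversalEnvelopingAlgebra K L]
        RepMod (charRep (μ (j + 1)) (hμ (j + 1))) :=
      { toFun := f
        map_add' := fun x y => hinj (by rw [map_add, hf, hf, hf, map_add, map_add])
        map_smul' := fun u y => hinj (by
          rw [RingHom.id_apply, map_smul, hf, hf, map_smul, map_smul]) }
    have hg' : ∀ y, inl (g' y) = G (R.d j y) := hf
    refine ⟨g', fun y => hinj ?_, fun n hn => ?_⟩
    · rw [hg', map_zero, (R.exact_succ j _).2 ⟨y, rfl⟩, map_zero]
    · obtain ⟨q, hq, ε, hε, hgq⟩ := hgn n hn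
      have hcomm : ∀ i k, UniversalEnvelopingAlgebra.ι K (n i) * UniversalEnvelopingAlgebra.ι K (n k)
          = UniversalEnvelopingAlgebra.ι K (n k) * UniversalEnvelopingAlgebra.ι K (n i) := by
        intro i k
        rw [← sub_eq_zero, ← LieRing.of_associative_ring_bracket, ← LieHom.map_lie, hn.comm,
          map_zero]
      choose q' hq' using fun I : {I : Finset ℕ // I.card = j + 1} => hq I.1 I.2
      classical
      -- Only sets with `j + 1` elements matter; the value `0` elsewhere is arbitrary.
      let Q : Finset ℕ → R.P (j + 1) := fun I =>
        if h : I.card = j + 1 then q' ⟨I, h⟩ else 0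
      have hQ : ∀ I : Finset ℕ, I.card = j + 1 → R.d j (Q I) =
          ∑ i ∈ I, pos i I • UniversalEnvelopingAlgebra.ι K (n i) • q (I.erase i) := by
        intro I h
        rw [← hq' ⟨I, h⟩]
        simp only [Q, dif_pos h]
      refine ⟨Q, fun I hI => ?_, ε * (pos j (Finset.range (j + 1)) : K), ?_, ?_⟩
      -- The Koszul boundary of `Q` is a cycle because the Koszul differential squares to zero,
      -- hence a boundary by exactness.
      · refine (R.exact_succ j _).1 ?_
        rw [map_sum, ← koszul_sq (fun i => UniversalEnvelopingAlgebra.ι K (n i)) hcomm q I]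
        refine Finset.sum_congr rfl fun i hi => ?_
        rw [map_zsmul, map_smul, hQ (I.erase i) (by rw [Finset.card_erase_of_mem hi, hI]; rfl)]
      · refine mul_ne_zero hε fun h => ?_
        have := congrArg (fun z : ℤ => (z : K)) (pos_sq j (Finset.range (j + 1)))
        simp [h] at this
      -- All characters vanish on `n i`, so it acts on the extension only through its off-diagonal
      -- entry `c j (n i)`.
      · have hfst : ∀ i p, (show K[X] × K[X] from G (UniversalEnvelopingAlgebra.ι K (n i) • p)).1 =
            c j (n i) * (show K[X] from g p) := by
          intro i p
          rw [map_smul, ι_smul_repMod, ← hG' p]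
          change C (μ (j + 1) (n i)) * X * _ + c j (n i) * _ = _
          rw [hn.char, map_zero, zero_mul, zero_mul, zero_add]
          rfl
        have hsum : (show K[X] from g' (Q (Finset.range (j + 1)))) =
            ∑ i ∈ Finset.range (j + 1), (pos i (Finset.range (j + 1)) : ℤ) •
              (c j (n i) * (show K[X] from g (q ((Finset.range (j + 1)).erase i)))) := by
          have h := congrArg (AddMonoidHom.fst K[X] K[X]) ((hg' (Q (Finset.range (j + 1)))).trans
            (congrArg G (hQ (Finset.range (j + 1)) (Finset.card_range _))))
          rw [map_sum] at h
          refine h.trans ((map_sum (AddMonoidHom.fst K[X] K[X]) _ _).trans ?_)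
          refine Finset.sum_congr rfl fun i _ => ?_
          rw [map_zsmul]
          refine (map_zsmul (AddMonoidHom.fst K[X] K[X]) _ _).trans ?_
          exact congrArg _ (hfst i _)
        have herase : (Finset.range (j + 1)).erase j = Finset.range j := by
          rw [Finset.range_add_one, Finset.erase_insert Finset.notMem_range_self]
        refine hsum.trans ?_
        -- `c j` kills every `n i` with `i ≠ j`, so a single term of the Koszul boundary survives.
        rw [Finset.sum_eq_single_of_mem j (Finset.self_mem_range_succ j) (fun i _ hi => by
          rw [hn.der i j hi, zero_mul, smul_zero]), herase, hgq, Finset.prod_range_succ,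
          zsmul_eq_mul, map_mul, map_intCast]
        ring

/-- Over a Lie algebra of type `FP_s`, the products of the values of `s` twisted derivations, whose
characters cancel out, range over a space of finite dimension. -/
theorem exists_finiteDimensional {s : ℕ} (hFP : LieAlgebra.IsFP K L s)
    (hμ : ∀ j, ∀ x y : L, μ j ⁅x, y⁆ = 0)
    (hc : ∀ j, ∀ x y : L, c j ⁅x, y⁆ =
      C (μ (j + 1) x - μ j x) * X * c j y - C (μ (j + 1) y - μ j y) * X * c j x)
    (h0 : μ 0 = 0) (hs : μ s = 0) :
    ∃ W : Submodule K K[X], FiniteDimensional K W ∧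
      ∀ n, IsAdmissible μ c n → ∏ i ∈ Finset.range s, c i (n i) ∈ W := by
  obtain ⟨R, hR⟩ := hFP
  have := hR s le_rfl
  obtain ⟨g, -, hg⟩ := exists_lift R μ hμ c hc h0 s
  obtain ⟨T, hT⟩ := Module.Finite.fg_top (R := UniversalEnvelopingAlgebra K L) (M := R.P s)
  -- Since `μ s = 0`, the target is a trivial module, so the `K`-span of the values on finitely many
  -- generators contains all values.
  let W : Submodule K (RepMod (charRep (μ s) (hμ s))) := Submodule.span K (g '' (T : Set (R.P s)))
  have hW : ∀ p, g p ∈ W := by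
    intro p
    have hp : p ∈ Submodule.span (UniversalEnvelopingAlgebra K L) (T : Set (R.P s)) :=
      hT ▸ Submodule.mem_top
    induction hp using Submodule.span_induction with
    | mem p hp => exact Submodule.subset_span ⟨p, hp, rfl⟩
    | zero => rw [map_zero]; exact W.zero_mem
    | add p p' _ _ h h' => rw [map_add]; exact W.add_mem h h'
    | smul u p _ h =>
      rw [map_smul]
      refine PBW.smul_mem_of_ι_smul_mem W (fun x v _ => ?_) u h
      rw [ι_smul_repMod]
      have hx : (charRep (μ s) (hμ s) x (show K[X] from v) : K[X]) = 0 := by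
        change C (μ s x) * X * (show K[X] from v) = 0
        rw [hs, LinearMap.zero_apply, map_zero, zero_mul, zero_mul]
      rw [hx]
      exact W.zero_mem
  refine ⟨W, FiniteDimensional.span_of_finite K (T.finite_toSet.image g), fun n hn => ?_⟩
  obtain ⟨q, -, ε, hε, h⟩ := hg n hn
  have h1 := W.smul_mem ε⁻¹ (hW (q (Finset.range s)))
  rw [h] at h1
  have h2 : ε⁻¹ • (C ε * ∏ i ∈ Finset.range s, c i (n i) : K[X]) =
      ∏ i ∈ Finset.range s, c i (n i) := by
    rw [smul_eq_C_mul, ← mul_assoc, ← C_mul, inv_mul_cancel₀ hε, C_1, one_mul]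
  rw [← h2]
  exact h1

end Lift

end KoszulLift

/-! ### Twisted derivations of free Lie algebras. -/

namespace TwistedDerivation

open Polynomial

/-- The Lie algebra of affine vector fields: `K` acts on the abelian Lie algebra `K[t]` through
multiples of `t`. -/
def Aff (K : Type*) [Field K] : Type _ := K × K[X]

section

variable {K : Type*} [Field K]

noncomputable instance : AddCommGroup (Aff K) := inferInstanceAs (AddCommGroup (K × K[X]))

noncomputable instance : Module K (Aff K) := inferInstanceAs (Module K (K × K[X]))

@[ext]
theorem Aff.ext {p q : Aff K} (h₁ : p.1 = q.1) (h₂ : p.2 = q.2) : p = q := Prod.ext h₁ h₂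

noncomputable instance : Bracket (Aff K) (Aff K) :=
  ⟨fun p q => ((0, C p.1 * X * q.2 - C q.1 * X * p.2) : K × K[X])⟩

theorem Aff.fst_lie (p q : Aff K) : ⁅p, q⁆.1 = 0 := rfl

theorem Aff.snd_lie (p q : Aff K) : ⁅p, q⁆.2 = C p.1 * X * q.2 - C q.1 * X * p.2 := rfl

theorem Aff.fst_add (p q : Aff K) : (p + q).1 = p.1 + q.1 := rfl

theorem Aff.snd_add (p q : Aff K) : (p + q).2 = p.2 + q.2 := rfl

theorem Aff.fst_smul (a : K) (p : Aff K) : (a • p).1 = a * p.1 := rfl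

theorem Aff.snd_smul (a : K) (p : Aff K) : (a • p).2 = C a * p.2 := smul_eq_C_mul a

noncomputable instance : LieRing (Aff K) where
  add_lie p q r := by
    ext1
    · simp only [Aff.fst_lie, Aff.fst_add, add_zero]
    · simp only [Aff.snd_lie, Aff.snd_add, Aff.fst_add, map_add]; ring
  lie_add p q r := by
    ext1
    · simp only [Aff.fst_lie, Aff.fst_add, add_zero]
    · simp only [Aff.snd_lie, Aff.snd_add, Aff.fst_add, map_add]; ring
  lie_self p := by
    ext1
    · rfl
    · exact sub_self _
  leibniz_lie p q r := by
    ext1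
    · simp only [Aff.fst_lie, Aff.fst_add, add_zero]
    · simp only [Aff.snd_lie, Aff.snd_add, Aff.fst_lie, map_zero]; ring

noncomputable instance : LieAlgebra K (Aff K) where
  lie_smul a p q := by
    ext1
    · simp only [Aff.fst_lie, Aff.fst_smul, mul_zero]
    · simp only [Aff.snd_lie, Aff.snd_smul, Aff.fst_smul, map_mul]; ring

end

section Free

variable {K : Type*} [Field K] {X : Type*}

theorem lieSpan_range_of : LieSubalgebra.lieSpan K (FreeLieAlgebra K X)
    (Set.range (FreeLieAlgebra.of K)) = ⊤ := by
  let S := LieSubalgebra.lieSpan K (FreeLieAlgebra K X) (Set.range (FreeLieAlgebra.of K))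
  let f : FreeLieAlgebra K X →ₗ⁅K⁆ S := FreeLieAlgebra.lift K fun x =>
    ⟨FreeLieAlgebra.of K x, LieSubalgebra.subset_lieSpan ⟨x, rfl⟩⟩
  have hf : S.incl.comp f = LieHom.id := FreeLieAlgebra.hom_ext fun x => by
    rw [LieHom.comp_apply, FreeLieAlgebra.lift_of_apply]; rfl
  refine top_le_iff.1 fun a _ => ?_
  have h := LieHom.congr_fun hf a
  rw [LieHom.comp_apply, LieHom.id_apply] at h
  rw [← h]
  exact (f a).2

variable {F : Type*} [LieRing F] [LieAlgebra K F]

/-- A linear map that vanishes on brackets and on free generators is zero. -/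
theorem eq_zero_of_generators (e : F ≃ₗ⁅K⁆ FreeLieAlgebra K X) (χ : F →ₗ[K] K)
    (hχ : ∀ x y : F, χ ⁅x, y⁆ = 0) (h : ∀ x, χ (e.symm (FreeLieAlgebra.of K x)) = 0) : χ = 0 := by
  let S : LieSubalgebra K (FreeLieAlgebra K X) :=
    { LinearMap.ker (χ ∘ₗ (e.symm : FreeLieAlgebra K X →ₗ[K] F)) with
      lie_mem' := fun {a b} _ _ => by
        change χ (e.symm ⁅a, b⁆) = 0
        rw [LieEquiv.map_lie, hχ] }
  have hS : LieSubalgebra.lieSpan K _ (Set.range (FreeLieAlgebra.of K)) ≤ S := by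
    rw [LieSubalgebra.lieSpan_le]
    rintro _ ⟨x, rfl⟩
    exact h x
  rw [lieSpan_range_of] at hS
  refine LinearMap.ext fun a => ?_
  have h1 : χ (e.symm (e a)) = 0 := hS (LieSubalgebra.mem_top (R := K) (e a))
  rwa [LieEquiv.symm_apply_apply] at h1

theorem isLieAbelian_of_subsingleton [Subsingleton X] (e : F ≃ₗ⁅K⁆ FreeLieAlgebra K X) (x : X) :
    IsLieAbelian F := by
  let S : LieSubalgebra K (FreeLieAlgebra K X) :=
    { Submodule.span K {FreeLieAlgebra.of K x} with
      lie_mem' := fun {a b} ha hb => by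
        obtain ⟨α, rfl⟩ := Submodule.mem_span_singleton.1 ha
        obtain ⟨β, rfl⟩ := Submodule.mem_span_singleton.1 hb
        rw [smul_lie, lie_smul, lie_self, smul_zero, smul_zero]
        exact Submodule.zero_mem _ }
  have hS : LieSubalgebra.lieSpan K _ (Set.range (FreeLieAlgebra.of K)) ≤ S := by
    rw [LieSubalgebra.lieSpan_le]
    rintro _ ⟨z, rfl⟩
    rw [Subsingleton.elim z x]
    exact Submodule.mem_span_singleton_self _
  rw [lieSpan_range_of] at hS
  refine ⟨fun a b => e.injective ?_⟩
  obtain ⟨α, hα⟩ := Submodule.mem_span_singleton.1 (hS (LieSubalgebra.mem_top (R := K) (e a)))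
  obtain ⟨β, hβ⟩ := Submodule.mem_span_singleton.1 (hS (LieSubalgebra.mem_top (R := K) (e b)))
  change e ⁅a, b⁆ = e 0
  rw [LieEquiv.map_lie, ← hα, ← hβ, smul_lie, lie_smul, lie_self, smul_zero, smul_zero]
  exact (map_zero (e : F →ₗ⁅K⁆ FreeLieAlgebra K X)).symm

attribute [local instance 100] LieRing.ofAssociativeRing

/-- A nonzero character of a non-abelian free Lie algebra admits a twisted derivation that takes
the value `1` and kills an element which is not killed by the character. -/
theorem exists_twistedDerivation (e : F ≃ₗ⁅K⁆ FreeLieAlgebra K X) (hF : ¬ IsLieAbelian F)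
    (χ : F →ₗ[K] K) (hχ : ∀ x y : F, χ ⁅x, y⁆ = 0) (h0 : χ ≠ 0) :
    ∃ (x y : F) (c : F →ₗ[K] K[X]),
      (∀ a b : F, c ⁅a, b⁆ = C (χ a) * Polynomial.X * c b - C (χ b) * Polynomial.X * c a) ∧
      χ x ≠ 0 ∧ c x = 0 ∧ c y = 1 := by
  classical
  obtain ⟨x, hx⟩ : ∃ x, χ (e.symm (FreeLieAlgebra.of K x)) ≠ 0 := by
    by_contra! h
    exact h0 (eq_zero_of_generators e χ hχ h)
  obtain ⟨y, hy⟩ : ∃ y, y ≠ x := by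
    by_contra! h
    have : Subsingleton X := ⟨fun a b => (h a).trans (h b).symm⟩
    exact hF (isLieAbelian_of_subsingleton e x)
  -- The second component of a homomorphism into `Aff K` is a derivation twisted by the first.
  -- Freeness allows any values on generators, and a second generator `y` leaves room for `c x = 0`.
  let f : X → Aff K := fun z =>
    ((χ (e.symm (FreeLieAlgebra.of K z)), if z = y then 1 else 0) : K × K[X])
  let Φ : FreeLieAlgebra K X →ₗ⁅K⁆ Aff K := FreeLieAlgebra.lift K f
  have hf : ∀ z, Φ (FreeLieAlgebra.of K z) = f z := FreeLieAlgebra.lift_of_apply f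
  let p₁ : Aff K →ₗ⁅K⁆ K :=
    { LinearMap.fst K K K[X] with
      map_lie' := fun {a b} => by
        rw [LieRing.of_associative_ring_bracket, mul_comm, sub_self]; rfl }
  let χ' : FreeLieAlgebra K X →ₗ⁅K⁆ K :=
    { χ ∘ₗ (e.symm : FreeLieAlgebra K X →ₗ[K] F) with
      map_lie' := fun {a b} => by
        rw [LieRing.of_associative_ring_bracket, mul_comm, sub_self]
        change χ (e.symm ⁅a, b⁆) = 0
        rw [LieEquiv.map_lie, hχ] }
  have hΦ : p₁.comp Φ = χ' := FreeLieAlgebra.hom_ext fun z =>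
    congrArg Prod.fst (hf z)
  have hΦ₁ : ∀ a, (Φ (e a)).1 = χ a := fun a => by
    have h : (Φ (e a)).1 = χ (e.symm (e a)) := LieHom.congr_fun hΦ (e a)
    rwa [LieEquiv.symm_apply_apply] at h
  have hΦ₂ : ∀ z, (Φ (e (e.symm (FreeLieAlgebra.of K z)))).2 = if z = y then 1 else 0 := fun z => by
    rw [LieEquiv.apply_symm_apply]
    exact congrArg Prod.snd (hf z)
  let c : F →ₗ[K] K[X] := LinearMap.snd K K K[X] ∘ₗ
    (Φ : FreeLieAlgebra K X →ₗ[K] Aff K) ∘ₗ (e : F →ₗ[K] FreeLieAlgebra K X)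
  have hc : ∀ a, c a = (Φ (e a)).2 := fun _ => rfl
  refine ⟨e.symm (FreeLieAlgebra.of K x), e.symm (FreeLieAlgebra.of K y), c, fun a b => ?_, hx,
    ?_, ?_⟩
  · rw [hc, LieEquiv.map_lie, LieHom.map_lie, Aff.snd_lie, hΦ₁, hΦ₁, hc, hc]
  · rw [hc, hΦ₂, if_neg hy.symm]
  · rw [hc, hΦ₂, if_pos rfl]

/-- As `c x = 0`, bracketing with `x` multiplies the value of `c` by `χ x` times the variable. This
is the source of unbounded degrees. -/
theorem apply_ad_pow {χ : F →ₗ[K] K} {c : F →ₗ[K] K[X]}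
    (hc : ∀ a b : F, c ⁅a, b⁆ = C (χ a) * Polynomial.X * c b - C (χ b) * Polynomial.X * c a)
    {x y : F} (hx : c x = 0) (hy : c y = 1) (m : ℕ) :
    c ((fun z => ⁅x, z⁆)^[m] y) = C (χ x ^ m) * Polynomial.X ^ m := by
  induction m with
  | zero => simp [hy]
  | succ m ih =>
    rw [Function.iterate_succ_apply', hc, ih, hx, pow_succ, pow_succ, C_mul]
    ring

end Free

theorem exists_natDegree_le {K : Type*} [Field K] (W : Submodule K K[X]) [FiniteDimensional K W] :
    ∃ N : ℕ, ∀ f ∈ W, f.natDegree ≤ N := by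
  obtain ⟨T, hT⟩ := (Module.Finite.iff_fg (N := W)).1 inferInstance
  refine ⟨T.sup natDegree, fun f hf => ?_⟩
  have h : W ≤ degreeLE K (T.sup natDegree : ℕ) := by
    rw [← hT, Submodule.span_le]
    intro g hg
    rw [SetLike.mem_coe, mem_degreeLE]
    exact degree_le_of_natDegree_le (Finset.le_sup (f := natDegree) hg)
  exact natDegree_le_of_degree_le (mem_degreeLE.1 (h hf))

end TwistedDerivation

/-! ### Induction on the number of factors. -/

namespace Subdirect

open Polynomial

section

variable {K : Type v} [Field K] {k : ℕ} {F : Fin k → Type u} [∀ i, LieRing (F i)]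
  [∀ i, LieAlgebra K (F i)] {L : Type u} [LieRing L] [LieAlgebra K L] (p : ∀ i, L →ₗ⁅K⁆ F i)

/-- The projection to any `t` of the factors is surjective. -/
def IsSurj (t : ℕ) : Prop :=
  ∀ S : Finset (Fin k), S.card ≤ t → ∀ a : ∀ i, F i, ∃ l : L, ∀ i ∈ S, p i l = a i

variable {p}

/-- Bracketing with an element that is `x` at `i` and `0` at `j` kills the coordinate at `j` and
keeps the others that already vanish. Surjectivity onto pairs suffices. -/
theorem exists_iterate_bracket {t : ℕ} (ht : 2 ≤ t) (h : IsSurj p t) {i : Fin k} (x : F i)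
    (T : Finset (Fin k)) (hT : i ∉ T) (z : F i) :
    ∃ n : L, p i n = (fun z => ⁅x, z⁆)^[T.card] z ∧ ∀ j ∈ T, p j n = 0 := by
  induction T using Finset.induction_on with
  | empty =>
    obtain ⟨l, hl⟩ := h {i} ((Finset.card_singleton i).le.trans (by omega)) (Pi.single i z)
    exact ⟨l, (hl i (Finset.mem_singleton_self i)).trans (Pi.single_eq_same i z), by simp⟩
  | insert j T hj ih =>
    rw [Finset.mem_insert, not_or] at hT
    obtain ⟨n, hn, hnT⟩ := ih hT.2
    obtain ⟨l, hl⟩ := h {i, j} (Finset.card_le_two.trans ht) (Pi.single i x)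
    refine ⟨⁅l, n⁆, ?_, fun j' hj' => ?_⟩
    · rw [LieHom.map_lie, hl i (by simp), hn, Finset.card_insert_of_notMem hj,
        Function.iterate_succ_apply', Pi.single_eq_same]
    · rw [LieHom.map_lie]
      rcases Finset.mem_insert.1 hj' with rfl | hj'
      · rw [hl j' (by simp), Pi.single_eq_of_ne (Ne.symm hT.1), zero_lie]
      · rw [hnT j' hj', lie_zero]

/-- If `χ i` vanished, the functional would see only `t` coordinates, on which `a` agrees with an
element of `L`. -/
theorem character_ne_zero {t : ℕ} (h : IsSurj p t) {S : Finset (Fin k)} (hS : S.card ≤ t + 1)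
    (χ : ∀ i, F i →ₗ[K] K) (hχ : ∀ l : L, ∑ i ∈ S, χ i (p i l) = 0)
    {a : ∀ i, F i} (ha : ∑ i ∈ S, χ i (a i) ≠ 0) {i : Fin k} (hi : i ∈ S) : χ i ≠ 0 := by
  intro h0
  obtain ⟨l, hl⟩ := h (S.erase i) (by rw [Finset.card_erase_of_mem hi]; omega) a
  refine ha ((Finset.sum_congr rfl fun j hj => ?_).trans (hχ l))
  by_cases hji : j = i
  · subst hji
    rw [h0, LinearMap.zero_apply, LinearMap.zero_apply]
  · rw [hl j (Finset.mem_erase.2 ⟨hji, hj⟩)]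

/-- Take `l` equal to `x` at `i` and zero on `S` away from `i` and one further index `i'`, and `l'`
equal to `y` at `i` and zero at `i'`. On `S` their bracket is supported at `i`. -/
theorem character_lie {t : ℕ} (ht : 2 ≤ t) (h : IsSurj p t) {S : Finset (Fin k)}
    (hS : S.card = t + 1) (χ : ∀ i, F i →ₗ[K] K) (hχ : ∀ l : L, ∑ i ∈ S, χ i (p i l) = 0)
    {i : Fin k} (hi : i ∈ S) (x y : F i) : χ i ⁅x, y⁆ = 0 := by
  obtain ⟨i', hi', hne⟩ := Finset.exists_mem_ne (s := S) (by omega) i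
  obtain ⟨l, hl⟩ := h (S.erase i') (by rw [Finset.card_erase_of_mem hi']; omega) (Pi.single i x)
  obtain ⟨l', hl'⟩ := h {i, i'} (Finset.card_le_two.trans ht) (Pi.single i y)
  rw [← hχ ⁅l, l'⁆, Finset.sum_eq_single_of_mem i hi fun j hj hji => ?_]
  · rw [LieHom.map_lie, hl i (Finset.mem_erase.2 ⟨hne.symm, hi⟩), hl' i (by simp),
      Pi.single_eq_same, Pi.single_eq_same]
  · rw [LieHom.map_lie]
    by_cases hji' : j = i'
    · subst hji'
      rw [hl' j (by simp), Pi.single_eq_of_ne hne, lie_zero, map_zero]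
    · rw [hl j (Finset.mem_erase.2 ⟨hji', hj⟩), Pi.single_eq_of_ne hji, zero_lie, map_zero]

/-- A tuple which is not attained is separated from the attained ones by linear functionals. -/
theorem exists_characters (S : Finset (Fin k)) (a : ∀ i, F i)
    (ha : ¬ ∃ l : L, ∀ i ∈ S, p i l = a i) :
    ∃ χ : ∀ i, F i →ₗ[K] K, (∀ l : L, ∑ i ∈ S, χ i (p i l) = 0) ∧ ∑ i ∈ S, χ i (a i) ≠ 0 := by
  let P : L →ₗ[K] ∀ i : S, F i := LinearMap.pi fun i => (p i : L →ₗ[K] F i)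
  have hP : (fun i : S => a i) ∉ LinearMap.range P := by
    rintro ⟨l, hl⟩
    exact ha ⟨l, fun i hi => congrFun hl ⟨i, hi⟩⟩
  obtain ⟨χ, hχa, hχ⟩ := Submodule.exists_le_ker_of_notMem hP
  let χ' : ∀ i, F i →ₗ[K] K := fun i =>
    if hi : i ∈ S then χ ∘ₗ LinearMap.single K (fun i : S => F i) ⟨i, hi⟩ else 0
  have hχ' : ∀ b : ∀ i, F i, ∑ i ∈ S, χ' i (b i) = χ fun i : S => b i := by
    intro b
    rw [← Finset.sum_coe_sort S, ← LinearMap.sum_single_apply (fun i : S => F i) (fun i : S => b i),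
      map_sum]
    refine Finset.sum_congr rfl fun i _ => ?_
    simp only [χ', dif_pos i.2]
    rfl
  exact ⟨χ', fun l => (hχ' fun i => p i l).trans (hχ ⟨l, rfl⟩), by rwa [hχ']⟩

theorem isSurj_two (hinj : ∀ x : L, (∀ i, p i x = 0) → x = 0)
    (hFP : LieAlgebra.IsFP K L 2)
    (hfree : ∀ i, LieAlgebra.IsFreeLie K (F i)) (hfg : ∀ i, LieAlgebra.IsFGLie K (F i))
    (hp : ∀ i, Function.Surjective (p i))
    (hN : ∀ i, ∃ n : L, p i n ≠ 0 ∧ ∀ j, j ≠ i → p j n = 0) : IsSurj p 2 := by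
  have key : ∀ i j, i ≠ j → ∀ a : ∀ i, F i, ∃ l : L, p i l = a i ∧ p j l = a j := by
    intro i j hij a
    obtain ⟨X₁, ⟨e₁⟩⟩ := hfree i
    obtain ⟨X₂, ⟨e₂⟩⟩ := hfree j
    have := FreeWords.finite_of_isFGLie e₁ (hfg i)
    have := FreeWords.finite_of_isFGLie e₂ (hfg j)
    have := Fintype.ofFinite X₁
    have := Fintype.ofFinite X₂
    obtain ⟨n, hn, hn0⟩ := hN i
    obtain ⟨n', hn', hn'0⟩ := hN j
    obtain ⟨l, hl⟩ := hp i (a i)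
    -- `n` is supported at `i`, hence commutes with the kernel of `p i`, coordinate by coordinate.
    obtain ⟨m, hm, hm'⟩ := FreeWords.exists_ker_eq hFP e₁ e₂ (p i) (hp i) (p j) (hp j) n hn
      (fun m hm => hinj _ fun i' => by
        rw [LieHom.map_lie]
        by_cases h : i' = i
        · subst h; rw [hm, lie_zero]
        · rw [hn0 i' h, zero_lie]) n' (hn'0 i hij) hn' (a j - p j l)
    exact ⟨l + m, by rw [map_add, hl, hm, add_zero], by rw [map_add, hm', add_sub_cancel]⟩
  intro S hS a
  rcases Nat.lt_or_ge S.card 2 with h | h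
  · rcases Nat.lt_or_ge S.card 1 with h | h
    · exact ⟨0, fun i hi => by simp_all⟩
    · obtain ⟨i, rfl⟩ := Finset.card_eq_one.1 (le_antisymm (by omega) h)
      obtain ⟨l, hl⟩ := hp i (a i)
      exact ⟨l, fun j hj => by rw [Finset.mem_singleton] at hj; subst hj; exact hl⟩
  · obtain ⟨i, j, hij, rfl⟩ := Finset.card_eq_two.1 (le_antisymm hS h)
    obtain ⟨l, hl, hl'⟩ := key i j hij a
    refine ⟨l, fun i' hi' => ?_⟩
    rcases Finset.mem_insert.1 hi' with rfl | hi'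
    · exact hl
    · rw [Finset.mem_singleton] at hi'; subst hi'; exact hl'

/-- A missed tuple yields characters with zero sum on `L`. The cup product of their twisted
derivations then takes values of unbounded degree, against `FP_{t+1}`. -/
theorem isSurj_succ (hinj : ∀ x : L, (∀ i, p i x = 0) → x = 0)
    {t : ℕ} (ht : 2 ≤ t) (h : IsSurj p t) (hFP : LieAlgebra.IsFP K L (t + 1))
    (hfree : ∀ i, LieAlgebra.IsFreeLie K (F i)) (hna : ∀ i, ¬ IsLieAbelian (F i)) :
    IsSurj p (t + 1) := by
  intro S hS a
  rcases Nat.lt_or_ge S.card (t + 1) with hlt | hge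
  · exact h S (by omega) a
  have hcard : S.card = t + 1 := le_antisymm hS hge
  by_contra ha
  obtain ⟨χ, hχ, hχa⟩ := exists_characters S a ha
  have hlie : ∀ i ∈ S, ∀ x y : F i, χ i ⁅x, y⁆ = 0 := fun i hi =>
    character_lie ht h hcard χ hχ hi
  have hex : ∀ i ∈ S, ∃ (x y : F i) (c : F i →ₗ[K] K[X]),
      (∀ a b : F i, c ⁅a, b⁆ = C (χ i a) * X * c b - C (χ i b) * X * c a) ∧
      χ i x ≠ 0 ∧ c x = 0 ∧ c y = 1 := fun i hi => by
    obtain ⟨X, ⟨e⟩⟩ := hfree i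
    exact TwistedDerivation.exists_twistedDerivation e (hna i) (χ i) (hlie i hi)
      (character_ne_zero h hS χ hχ hχa hi)
  choose! x y c hc hx hcx hcy using hex
  have hkpos : 2 ≤ k := by
    have := Finset.card_le_univ S
    rw [Fintype.card_fin] at this
    omega
  let σ : Fin (t + 1) ≃ S := (S.equivFinOfCardEq hcard).symm
  -- An enumeration of `S`, continued periodically. It is injective only below `t + 1`, which is why
  -- `δ` and `n'` are cut off there.
  let e : ℕ → Fin k := fun j => σ (Fin.ofNat (t + 1) j)
  have heS : ∀ j, e j ∈ S := fun j => (σ _).2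
  have hσ : ∀ j : Fin (t + 1), e j = σ j := fun j => by
    simp only [e, Fin.ofNat_eq_cast, Fin.cast_val_eq_self]
  have heinj : ∀ i < t + 1, ∀ j < t + 1, e i = e j → i = j := by
    intro i hi j hj hij
    have := σ.injective (Subtype.ext ((hσ ⟨i, hi⟩).symm.trans (hij.trans (hσ ⟨j, hj⟩))))
    exact Fin.mk.inj_iff.1 this
  have hsum : ∀ f : Fin k → K, ∑ j ∈ Finset.range (t + 1), f (e j) = ∑ i ∈ S, f i := by
    intro f
    rw [← Fin.sum_univ_eq_sum_range (fun j => f (e j)), ← Finset.sum_coe_sort S]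
    exact Fintype.sum_equiv σ _ _ fun j => congrArg f (hσ j)
  let ψ : ℕ → L →ₗ[K] K := fun j => χ (e j) ∘ₗ (p (e j) : L →ₗ[K] F (e j))
  have hψ : ∀ j l, ψ j l = χ (e j) (p (e j) l) := fun _ _ => rfl
  -- Partial sums: consecutive ones differ by one character, as the extensions require, and the one
  -- at `t + 1` vanishes on `L`.
  let μ : ℕ → L →ₗ[K] K := fun j => ∑ i ∈ Finset.range j, ψ i
  have hμ : ∀ j l, μ j l = ∑ i ∈ Finset.range j, χ (e i) (p (e i) l) := fun j l => by
    simp only [μ, LinearMap.sum_apply, hψ]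
  let δ : ℕ → L →ₗ[K] K[X] := fun j =>
    if j < t + 1 then c (e j) ∘ₗ (p (e j) : L →ₗ[K] F (e j)) else 0
  have hδ : ∀ j < t + 1, ∀ l, δ j l = c (e j) (p (e j) l) := fun j hj l => by
    simp only [δ, if_pos hj]
    rfl
  have hδ0 : ∀ j, ¬ j < t + 1 → δ j = 0 := fun j hj => if_neg hj
  obtain ⟨W, hW, hmem⟩ := KoszulLift.exists_finiteDimensional μ δ hFP
    (fun j x y => by
      rw [hμ]
      refine Finset.sum_eq_zero fun i _ => ?_
      rw [LieHom.map_lie, hlie _ (heS i)])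
    (fun j x y => by
      by_cases hj : j < t + 1
      · simp only [μ, Finset.sum_range_succ, LinearMap.add_apply, add_sub_cancel_left, hψ]
        rw [hδ j hj, hδ j hj, hδ j hj, LieHom.map_lie, hc _ (heS j)]
      · simp only [hδ0 j hj, LinearMap.zero_apply, mul_zero, sub_zero])
    (Finset.sum_range_zero ψ) (LinearMap.ext fun l => by
      rw [hμ, hsum fun i => χ i (p i l), hχ, LinearMap.zero_apply])
  obtain ⟨N, hN⟩ := TwistedDerivation.exists_natDegree_le W
  -- The `k - 1` outer brackets kill the other coordinates, and the `N` inner ones push the degree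
  -- beyond the bound. By `hkpos` there is at least one bracket, so characters vanish on `n`.
  have hn : ∀ i, ∃ n : L, p i n = (fun z => ⁅x i, z⁆)^[k - 1 + N] (y i) ∧
      ∀ j, j ≠ i → p j n = 0 := by
    intro i
    obtain ⟨n, hn, hn0⟩ := exists_iterate_bracket ht h (x i) (Finset.univ.erase i)
      (Finset.notMem_erase i _) ((fun z => ⁅x i, z⁆)^[N] (y i))
    refine ⟨n, ?_, fun j hj => hn0 j (Finset.mem_erase.2 ⟨hj, Finset.mem_univ j⟩)⟩
    rw [hn, ← Function.iterate_add_apply, Finset.card_erase_of_mem (Finset.mem_univ i),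
      Finset.card_univ, Fintype.card_fin]
  choose n hn hn0 using hn
  let n' : ℕ → L := fun j => if j < t + 1 then n (e j) else 0
  have hn'1 : ∀ j < t + 1, n' j = n (e j) := fun j hj => if_pos hj
  have hn'2 : ∀ j, ¬ j < t + 1 → n' j = 0 := fun j hj => if_neg hj
  have hadm : KoszulLift.IsAdmissible μ δ n' := by
    refine ⟨fun i j => ?_, fun i j => ?_, fun i j hij => ?_⟩
    · by_cases hi : i < t + 1
      · by_cases hj : j < t + 1
        · rw [hn'1 i hi, hn'1 j hj]
          by_cases hij : e i = e j
          · rw [hij, lie_self]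
          · refine hinj _ fun r => ?_
            rw [LieHom.map_lie]
            by_cases hr : r = e i
            · rw [hn0 (e j) r (hr ▸ hij), lie_zero]
            · rw [hn0 (e i) r hr, zero_lie]
        · rw [hn'2 j hj, lie_zero]
      · rw [hn'2 i hi, zero_lie]
    · by_cases hi : i < t + 1
      · rw [hμ, hn'1 i hi]
        refine Finset.sum_eq_zero fun l _ => ?_
        by_cases hl : e l = e i
        · rw [hl, hn, show k - 1 + N = (k - 2 + N) + 1 by omega, Function.iterate_succ_apply',
            hlie _ (heS i)]
        · rw [hn0 _ _ hl, map_zero]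
      · rw [hn'2 i hi, map_zero]
    · by_cases hi : i < t + 1
      · by_cases hj : j < t + 1
        · rw [hn'1 i hi, hδ j hj, hn0 _ _ fun h => hij (heinj j hj i hi h).symm, map_zero]
        · rw [hδ0 j hj, LinearMap.zero_apply]
      · rw [hn'2 i hi, map_zero]
  have hprod := hN _ (hmem n' hadm)
  have hval : ∀ i ∈ Finset.range (t + 1), δ i (n' i) =
      C (χ (e i) (x (e i)) ^ (k - 1 + N)) * X ^ (k - 1 + N) := fun i hi => by
    have hi := Finset.mem_range.1 hi
    rw [hδ i hi, hn'1 i hi, hn, TwistedDerivation.apply_ad_pow (hc _ (heS i)) (hcx _ (heS i))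
      (hcy _ (heS i))]
  rw [Finset.prod_congr rfl hval, Finset.prod_mul_distrib, ← map_prod, Finset.prod_const,
    Finset.card_range, ← pow_mul, natDegree_C_mul_X_pow _ _
      (Finset.prod_ne_zero_iff.2 fun i _ => pow_ne_zero _ (hx _ (heS i)))] at hprod
  -- The product has degree `(k - 1 + N) * (t + 1)`, which exceeds `N`.
  have := Nat.le_mul_of_pos_right (k - 1 + N) (show 0 < t + 1 by omega)
  omega

theorem isSurj_of_isFP (hinj : ∀ x : L, (∀ i, p i x = 0) → x = 0)
    {s : ℕ} (hs : 2 ≤ s) (hFP : LieAlgebra.IsFP K L s)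
    (hfree : ∀ i, LieAlgebra.IsFreeLie K (F i)) (hfg : ∀ i, LieAlgebra.IsFGLie K (F i))
    (hna : ∀ i, ¬ IsLieAbelian (F i)) (hp : ∀ i, Function.Surjective (p i))
    (hN : ∀ i, ∃ n : L, p i n ≠ 0 ∧ ∀ j, j ≠ i → p j n = 0) : IsSurj p s := by
  induction s, hs using Nat.le_induction with
  | base => exact isSurj_two hinj hFP hfree hfg hp hN
  | succ t ht ih =>
    obtain ⟨R, hR⟩ := id hFP
    exact isSurj_succ hinj ht (ih ⟨R, fun i hi => hR i (by omega)⟩) hFP hfree hna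

end

end Subdirect

theorem theoremA {K : Type v} [Field K] (s : ℕ) (hs : 2 ≤ s) (k : ℕ)
    (F : Fin k → Type u) [∀ i, LieRing (F i)] [∀ i, LieAlgebra K (F i)]
    (hfree : ∀ i, LieAlgebra.IsFreeLie K (F i))
    (hfg : ∀ i, LieAlgebra.IsFGLie K (F i))
    (hna : ∀ i, ¬ IsLieAbelian (F i))
    (L : LieSubalgebra K (⨁ i, F i))
    (hsub : LieAlgebra.IsSubdirectSum K L)
    (hint : ∀ i, L ⊓ (DirectSum.lieAlgebraOf K (Fin k) F i).range ≠ ⊥)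
    (hFP : LieAlgebra.IsFP K L s)
    (e : Fin s → Fin k) (he : StrictMono e) :
    L.map (LieAlgebra.directSumProj K F e he.injective) = ⊤ := by
  let p : ∀ i, L →ₗ⁅K⁆ F i := fun i => (DirectSum.lieAlgebraComponent K (Fin k) F i).comp L.incl
  have hpa : ∀ i (l : L), p i l = (l : ⨁ i, F i) i := fun _ _ => rfl
  have h : Subdirect.IsSurj p s := by
    refine Subdirect.isSurj_of_isFP (fun x hx => ?_) hs hFP hfree hfg hna (fun i y => ?_)
      fun i => ?_
    · exact Subtype.ext (DFinsupp.ext hx)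
    · have hy : y ∈ L.map (DirectSum.lieAlgebraComponent K (Fin k) F i) := by
        rw [hsub i]; exact LieSubalgebra.mem_top y
      obtain ⟨l, hl, rfl⟩ := (LieSubalgebra.mem_map _ _ _).1 hy
      exact ⟨⟨l, hl⟩, rfl⟩
    · obtain ⟨n, ⟨hn, z, hz⟩, hn0⟩ : ∃ n ∈ L ⊓ (DirectSum.lieAlgebraOf K (Fin k) F i).range,
          n ≠ 0 := by
        by_contra! hbot
        exact hint i ((LieSubalgebra.eq_bot_iff _).2 hbot)
      have hz0 : ∀ j, j ≠ i → n j = 0 := fun j hj =>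
        hz ▸ DirectSum.of_eq_of_ne i j z hj
      refine ⟨⟨n, hn⟩, fun hi => hn0 (DFinsupp.ext fun j => ?_), fun j hj => hz0 j hj⟩
      by_cases hj : j = i
      · exact hj ▸ hi
      · exact hz0 j hj
  refine top_le_iff.1 fun y _ => ?_
  -- The tuple on the selected factors is extended by zero to all factors; injectivity of `e` makes
  -- this consistent.
  have hy : ∀ i, ∃ z : F i, ∀ j (hj : e j = i), hj ▸ y j = z := by
    intro i
    by_cases hi : ∃ j, e j = i
    · obtain ⟨j, rfl⟩ := hi
      refine ⟨y j, fun j' hj' => ?_⟩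
      obtain rfl := he.injective hj'
      rfl
    · exact ⟨0, fun j hj => absurd ⟨j, hj⟩ hi⟩
  choose a ha using hy
  obtain ⟨l, hl⟩ := h (Finset.univ.image e)
    (Finset.card_image_le.trans (Finset.card_fin s).le) a
  refine (LieSubalgebra.mem_map _ _ _).2 ⟨l, l.2, DFinsupp.ext fun j => ?_⟩
  rw [LieAlgebra.directSumProj_apply, ← hpa,
    hl (e j) (Finset.mem_image_of_mem e (Finset.mem_univ j)), ← ha (e j) j rfl]
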